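/- Say that a metric space $(X,d)$ excludes $K_{s,s}$ as a minor if there is a graph $G$ with positive edge weights that does not have the complete bipartite graph $K_{s,s}$ as a minor, such that $X$ is a subset of the vertex set of $G$ and $d$ is the restriction to $X$ of the shortest-path distance of $G$. There exist universal constants $C_1,C_2>0$ such that for all integers $s,n\ge 1$ and every $n$-point metric space $(X,d)$ that excludes $K_{s,s}$ as a minor there are an integer $k\ge 0$ with $k\le C_1\,3^s(\log s)\log n$ and a map $f:X\to\ell_\infty^k$ of distortion at most $C_2s^2$, i.e. for some $c>0$ and all $x,y\in X$, $$\frac{c}{C_2s^2}\,d(x,y)\le\|f(x)-f(y)\|_\infty\le c\,d(x,y).$$ -/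

import Mathlib

universe u v w

namespace MinorFreeMetric

/-- `H` is a minor of `G`: the vertices of `H` can be assigned pairwise disjoint vertex sets
(branch sets) of `G`, each inducing a connected (in particular nonempty) subgraph, so that adjacent
vertices of `H` have branch sets joined by an edge of `G`. -/
def IsMinor {W : Type w} {V : Type v} (H : SimpleGraph W) (G : SimpleGraph V) : Prop :=
  ∃ B : W → Set V,
    (∀ a, (G.induce (B a)).Connected) ∧
    (∀ a b, a ≠ b → Disjoint (B a) (B b)) ∧
    (∀ a b, H.Adj a b → ∃ x ∈ B a, ∃ y ∈ B b, G.Adj x y)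

/-- The length of a walk for given edge weights: the sum of the weights of its edges, counted
with multiplicity. -/
def walkLength {V : Type v} {G : SimpleGraph V} (wt : Sym2 V → ℝ) {x y : V}
    (p : G.Walk x y) : ℝ :=
  (p.edges.map wt).sum

/-- The metric space `X` excludes `K_{s,s}` as a minor: it is, up to renaming points, a subset of
the vertex set of a graph `G` with positive edge weights that has no `K_{s,s}` minor, with the
shortest-path distance of `G`. (The greatest lower bound is a minimum if `G` is finite. As the
empty set of reals has no greatest lower bound, any two points of `X` are joined by a walk.) -/
def ExcludesBicliqueMinor (X : Type u) [MetricSpace X] (s : ℕ) : Prop :=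
  ∃ (V : Type v) (G : SimpleGraph V) (wt : Sym2 V → ℝ) (ι : X ↪ V),
    (∀ e ∈ G.edgeSet, 0 < wt e) ∧
    ¬ IsMinor (completeBipartiteGraph (Fin s) (Fin s)) G ∧
    ∀ x y : X, IsGLB (Set.range fun p : G.Walk (ι x) (ι y) => walkLength wt p) (dist x y)

/-- `f` is `K`-bi-Lipschitz up to scaling, i.e. the distortion of `f` is at most `K`. -/
def DistortionAtMost {X : Type u} {Y : Type v} [MetricSpace X] [MetricSpace Y]
    (f : X → Y) (K : ℝ) : Prop :=
  ∃ c : ℝ, 0 < c ∧ ∀ x y : X,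
    c * K⁻¹ * dist x y ≤ dist (f x) (f y) ∧ dist (f x) (f y) ≤ c * dist x y

end MinorFreeMetric

/-! Excluding `K_{s,s}` gives `2 ^ s` padded partitions at every scale; chained over scales these
give hierarchies, and an order on the points turns each hierarchy into `O(log n)` coordinates.

Partitions, after Klein, Plotkin and Rao: `s` times, cut a connected piece into bands of width `δ`
of the distance from a root, and break the bands into connected pieces. If a final piece had
diameter above `11 * s ^ 2 * δ`, it would contain `s` vertices far apart. Undo the cuts one by one:
each time, tails of shortest paths to the root extend the left branch sets, and the ball around the
root that they reach is a new right branch set (`BicliqueStage.extend`). This ends in a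
`K_{s,s}`-minor (`linkedWithin_of_mem_cluster`). Each cut can be shifted in two ways, and for every
point one of the `2 ^ s` choices keeps all cuts away from it (`exists_cluster_padded`).

Coordinates: let `K = O(s ^ 2)` bound the ratio of diameter to padding. Along scales growing by `2 ^
A ≥ 4 * K` the partitions can be made nested at constant loss, and the points ordered so that all
classes are intervals (`exists_convex_order`). For `x`, `y` and a small padded class of `x`,
consider the smallest dyadic block of positions containing the class and `y`. If the class lies in
the half opposite to `y`, the boundary distance signed by the parity of the half separates `x` from
`y`. Otherwise the class contains the middle point of the block, and either the boundary distance or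
the distance to that point separates them (`exists_separating_functions`).

The scales split into `A = O(log s)` residue classes, so there are `2 ^ s * A * 3 * ⌈log₂ n⌉`
coordinates. -/

namespace MinorFreeMetric

/-! ### Walks of bounded length inside a vertex set -/

section Links

variable {V : Type v} {H : SimpleGraph V} {wt : Sym2 V → ℝ}

@[simp] theorem walkLength_nil (x : V) : walkLength wt (SimpleGraph.Walk.nil : H.Walk x x) = 0 := by
  simp [walkLength]

@[simp] theorem walkLength_cons {x y z : V} (h : H.Adj x y) (p : H.Walk y z) :
    walkLength wt (.cons h p) = wt s(x, y) + walkLength wt p := by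
  simp [walkLength]

theorem walkLength_append {x y z : V} (p : H.Walk x y) (q : H.Walk y z) :
    walkLength wt (p.append q) = walkLength wt p + walkLength wt q := by
  simp [walkLength, SimpleGraph.Walk.edges_append]

theorem walkLength_reverse {x y : V} (p : H.Walk x y) :
    walkLength wt p.reverse = walkLength wt p := by
  simp [walkLength, SimpleGraph.Walk.edges_reverse, List.sum_reverse]

theorem walkLength_nonneg (hpos : ∀ e ∈ H.edgeSet, 0 < wt e) {x y : V} (p : H.Walk x y) :
    0 ≤ walkLength wt p := by
  induction p with
  | nil => simp
  | cons h p ih =>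
    rw [walkLength_cons]
    have := hpos _ (H.mem_edgeSet.2 h)
    linarith

theorem le_walkLength_of_mem_edges (hpos : ∀ e ∈ H.edgeSet, 0 < wt e) {x y : V} (p : H.Walk x y)
    {e : Sym2 V} (he : e ∈ p.edges) : wt e ≤ walkLength wt p := by
  refine List.single_le_sum ?_ _ (List.mem_map_of_mem he)
  intro a ha
  obtain ⟨b, hb, rfl⟩ := List.mem_map.1 ha
  exact (hpos _ (p.edges_subset_edgeSet hb)).le

/-- The vertices `x` and `y` are joined by a walk of length at most `t` all of whose vertices lie
in `U`. -/
def LinkedWithin (H : SimpleGraph V) (wt : Sym2 V → ℝ) (U : Set V) (t : ℝ) (x y : V) : Prop :=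
  ∃ p : H.Walk x y, (∀ z ∈ p.support, z ∈ U) ∧ walkLength wt p ≤ t

namespace LinkedWithin

variable {U : Set V} {t t' : ℝ} {x y z : V}

theorem refl (hx : x ∈ U) (ht : 0 ≤ t) : LinkedWithin H wt U t x x :=
  ⟨.nil, by simpa using hx, by simpa using ht⟩

theorem symm (h : LinkedWithin H wt U t x y) : LinkedWithin H wt U t y x := by
  obtain ⟨p, hp, hl⟩ := h
  exact ⟨p.reverse, by simpa using hp, by rwa [walkLength_reverse]⟩

theorem trans (h : LinkedWithin H wt U t x y) (h' : LinkedWithin H wt U t' y z) :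
    LinkedWithin H wt U (t + t') x z := by
  obtain ⟨p, hp, hl⟩ := h
  obtain ⟨q, hq, hl'⟩ := h'
  refine ⟨p.append q, fun a ha => ?_, by rw [walkLength_append]; linarith⟩
  rcases (SimpleGraph.Walk.mem_support_append_iff p q).1 ha with h | h
  exacts [hp _ h, hq _ h]

theorem of_adj (h : H.Adj x y) (hx : x ∈ U) (hy : y ∈ U) :
    LinkedWithin H wt U (wt s(x, y)) x y :=
  ⟨.cons h .nil, by simp [hx, hy], by simp⟩

theorem mono {U' : Set V} (h : LinkedWithin H wt U t x y) (hU : U ⊆ U') (ht : t ≤ t') :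
    LinkedWithin H wt U' t' x y := by
  obtain ⟨p, hp, hl⟩ := h
  exact ⟨p, fun a ha => hU (hp a ha), hl.trans ht⟩

theorem left_mem (h : LinkedWithin H wt U t x y) : x ∈ U := by
  obtain ⟨p, hp, -⟩ := h
  exact hp _ p.start_mem_support

theorem right_mem (h : LinkedWithin H wt U t x y) : y ∈ U := h.symm.left_mem

theorem nonneg (hpos : ∀ e ∈ H.edgeSet, 0 < wt e) (h : LinkedWithin H wt U t x y) : 0 ≤ t := by
  obtain ⟨p, -, hl⟩ := h
  exact (walkLength_nonneg hpos p).trans hl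

theorem of_mem_support (hpos : ∀ e ∈ H.edgeSet, 0 < wt e) {p : H.Walk x y}
    (hp : ∀ z ∈ p.support, z ∈ U) (hl : walkLength wt p ≤ t) (hz : z ∈ p.support) :
    LinkedWithin H wt U t x z := by
  classical
  refine ⟨p.takeUntil z hz, fun a ha => hp a (p.support_takeUntil_subset_support hz ha), ?_⟩
  have h := walkLength_append (wt := wt) (p.takeUntil z hz) (p.dropUntil z hz)
  rw [p.take_spec hz] at h
  have := walkLength_nonneg hpos (p.dropUntil z hz)
  linarith

end LinkedWithin

theorem support_subset_of_adj_closed {U S : Set V} (hS : ∀ a ∈ S, ∀ b ∈ U, H.Adj a b → b ∈ S)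
    {x y : V} (p : H.Walk x y) (hx : x ∈ S) (hp : ∀ z ∈ p.support, z ∈ U) :
    ∀ z ∈ p.support, z ∈ S := by
  induction p with
  | nil => simpa using hx
  | cons h p ih =>
    intro z hz
    rw [SimpleGraph.Walk.support_cons, List.mem_cons] at hz
    rcases hz with rfl | hz
    · exact hx
    · refine ih (hS _ hx _ (hp _ ?_) h) (fun z hz => hp z ?_) z hz
      · simp
      · simp [hz]

/-- A link whose vertices cannot leave `S` is a link within `S`. -/
theorem LinkedWithin.restrict (hpos : ∀ e ∈ H.edgeSet, 0 < wt e) {U S : Set V} {t : ℝ} {x y : V}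
    (h : LinkedWithin H wt U t x y) (hx : x ∈ S)
    (hS : ∀ a ∈ S, ∀ b, LinkedWithin H wt U t x b → H.Adj a b → b ∈ S) :
    LinkedWithin H wt S t x y := by
  obtain ⟨p, hp, hl⟩ := h
  exact ⟨p, support_subset_of_adj_closed (U := {b | LinkedWithin H wt U t x b}) hS p hx
    (fun z hz => .of_mem_support hpos hp hl hz), hl⟩

theorem connected_of_linkedWithin {S : Set V} {x : V} (hx : x ∈ S)
    (h : ∀ y ∈ S, ∃ t, LinkedWithin H wt S t x y) : (H.induce S).Connected := by
  refine SimpleGraph.induce_connected_of_patches x hx fun {y} hy => ?_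
  obtain ⟨t, p, hp, -⟩ := h y hy
  exact ⟨{z | z ∈ p.support}, hp, p.start_mem_support, p.end_mem_support,
    p.connected_induce_support _ _⟩

theorem exists_adj_crossing {P : V → Prop} {x y : V} (p : H.Walk x y) (hx : P x) (hy : ¬ P y) :
    ∃ a ∈ p.support, ∃ b ∈ p.support, H.Adj a b ∧ P a ∧ ¬ P b := by
  induction p with
  | nil => exact absurd hx hy
  | @cons u v w h p ih =>
    by_cases hv : P v
    · obtain ⟨a, ha, b, hb, hab⟩ := ih hv hy
      exact ⟨a, by simp [ha], b, by simp [hb], hab⟩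
    · exact ⟨u, by simp, v, by simp, h, hx, hv⟩

end Links

/-! ### Distance from a root inside a vertex set -/

section Level

variable {V : Type v} {H : SimpleGraph V} {wt : Sym2 V → ℝ}

/-- The distance from `r` to `x` in the graph induced on `U`. -/
noncomputable def level (H : SimpleGraph V) (wt : Sym2 V → ℝ) (U : Set V) (r x : V) : ℝ :=
  sInf {t | LinkedWithin H wt U t r x}

variable {U : Set V} {r x y : V} {t : ℝ}

theorem level_bddBelow (hpos : ∀ e ∈ H.edgeSet, 0 < wt e) :
    BddBelow {t | LinkedWithin H wt U t r x} :=
  ⟨0, fun _ ht => LinkedWithin.nonneg hpos ht⟩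

theorem level_le (hpos : ∀ e ∈ H.edgeSet, 0 < wt e) (h : LinkedWithin H wt U t r x) :
    level H wt U r x ≤ t :=
  csInf_le (level_bddBelow hpos) h

theorem level_nonneg (hpos : ∀ e ∈ H.edgeSet, 0 < wt e) : 0 ≤ level H wt U r x :=
  Real.sInf_nonneg fun _ ht => LinkedWithin.nonneg hpos ht

theorem level_self (hpos : ∀ e ∈ H.edgeSet, 0 < wt e) (hr : r ∈ U) : level H wt U r r = 0 :=
  le_antisymm (level_le hpos (.refl hr le_rfl)) (level_nonneg hpos)

/-- As `sInf ∅ = 0`, levels are distances only at vertices joined to the root, hence the hypothesis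
on `x`. -/
theorem level_le_add (hpos : ∀ e ∈ H.edgeSet, 0 < wt e) (hx : ∃ s, LinkedWithin H wt U s r x)
    (h : LinkedWithin H wt U t x y) : level H wt U r y ≤ level H wt U r x + t := by
  rw [← sub_le_iff_le_add]
  refine le_csInf hx fun s hs => ?_
  have := level_le hpos (LinkedWithin.trans hs h)
  linarith

theorem abs_level_sub_le (hpos : ∀ e ∈ H.edgeSet, 0 < wt e)
    (hx : ∃ s, LinkedWithin H wt U s r x) (h : LinkedWithin H wt U t x y) :
    |level H wt U r x - level H wt U r y| ≤ t := by
  obtain ⟨s, hs⟩ := hx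
  have h1 := level_le_add hpos ⟨s, hs⟩ h
  have h2 := level_le_add hpos ⟨_, hs.trans h⟩ h.symm
  rw [abs_le]
  constructor <;> linarith

/-- In a finite graph a vertex other than the root has a neighbour on a shortest path to the
root. -/
theorem exists_parent (hpos : ∀ e ∈ H.edgeSet, 0 < wt e) (hU : U.Finite)
    (hx : ∃ s, LinkedWithin H wt U s r x) (hxr : x ≠ r) :
    ∃ y ∈ U, H.Adj x y ∧ level H wt U r y + wt s(x, y) ≤ level H wt U r x := by
  have last : ∀ s, LinkedWithin H wt U s r x →
      ∃ y ∈ U, H.Adj x y ∧ level H wt U r y + wt s(x, y) ≤ s := by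
    intro s hs
    obtain ⟨p, hp, hl⟩ := hs.symm
    cases p with
    | nil => exact absurd rfl hxr
    | @cons _ y _ h p =>
      rw [walkLength_cons] at hl
      refine ⟨y, hp _ (by simp), h, ?_⟩
      have : level H wt U r y ≤ walkLength wt p :=
        level_le hpos (LinkedWithin.symm ⟨p, fun z hz => hp z (by simp [hz]), le_rfl⟩)
      linarith
  -- The neighbour given by `last` depends on `s`; minimizing over the finitely many neighbours
  -- gives one that serves every `s`, so the infimum over `s` can be taken.
  have hfin : {y ∈ U | H.Adj x y}.Finite := hU.subset (Set.sep_subset _ _)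
  obtain ⟨s, hs⟩ := hx
  obtain ⟨y₀, hy₀, hxy₀, -⟩ := last s hs
  obtain ⟨y, ⟨hyU, hxy⟩, hmin⟩ := Set.exists_min_image _
    (fun y => level H wt U r y + wt s(x, y)) hfin ⟨y₀, hy₀, hxy₀⟩
  refine ⟨y, hyU, hxy, le_csInf ⟨s, hs⟩ fun s hs => ?_⟩
  obtain ⟨z, hzU, hxz, hz⟩ := last s hs
  exact (hmin z ⟨hzU, hxz⟩).trans hz

end Level

/-! ### Shortest paths toward the root -/

section Descent

variable {V : Type v} {H : SimpleGraph V} {wt : Sym2 V → ℝ} {U : Set V} {r : V}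

/-- `b` precedes `a` on a shortest path from `r` to `a` in the graph induced on `U`. -/
def Descends (H : SimpleGraph V) (wt : Sym2 V → ℝ) (U : Set V) (r a b : V) : Prop :=
  b ∈ U ∧ H.Adj a b ∧ level H wt U r b + wt s(a, b) ≤ level H wt U r a

theorem Descends.level_lt (hpos : ∀ e ∈ H.edgeSet, 0 < wt e) {a b : V}
    (h : Descends H wt U r a b) : level H wt U r b < level H wt U r a := by
  have := hpos _ (H.mem_edgeSet.2 h.2.1)
  linarith [h.2.2]

theorem mem_of_descends {a b : V} (ha : a ∈ U)
    (h : Relation.ReflTransGen (Descends H wt U r) a b) : b ∈ U := by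
  cases h with
  | refl => exact ha
  | tail _ h => exact h.1

/-- Each step is no longer than the drop in level, so the lengths telescope. The set `S` is left
free in order to confine the path to a band. -/
theorem linkedWithin_of_descends (hpos : ∀ e ∈ H.edgeSet, 0 < wt e) {a b : V}
    (h : Relation.ReflTransGen (Descends H wt U r) a b) {S : Set V}
    (hS : ∀ z, Relation.ReflTransGen (Descends H wt U r) a z →
      level H wt U r b ≤ level H wt U r z → z ∈ S) :
    LinkedWithin H wt S (level H wt U r a - level H wt U r b) a b := by
  induction h with
  | refl => exact .refl (hS _ .refl le_rfl) (by simp)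
  | @tail b c hab hbc ih =>
    have hlt := hbc.level_lt hpos
    refine ((ih fun z hz hbz => hS z hz (hlt.le.trans hbz)).trans
      (.of_adj hbc.2.1 (hS _ hab hlt.le) (hS _ (hab.tail hbc) le_rfl))).mono subset_rfl ?_
    linarith [hbc.2.2]

theorem descends_root (hpos : ∀ e ∈ H.edgeSet, 0 < wt e) (hU : U.Finite)
    (hr : ∀ x ∈ U, ∃ s, LinkedWithin H wt U s r x) {a : V} (ha : a ∈ U) :
    Relation.ReflTransGen (Descends H wt U r) a r := by
  obtain ⟨b, hab, hmin⟩ := Set.exists_min_image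
    {b | Relation.ReflTransGen (Descends H wt U r) a b} (level H wt U r)
    (hU.subset fun b hb => mem_of_descends ha hb) ⟨a, .refl⟩
  by_cases hbr : b = r
  · exact hbr ▸ hab
  · obtain ⟨c, hc, hbc, hl⟩ := exists_parent hpos hU (hr b (mem_of_descends ha hab)) hbr
    have hd : Descends H wt U r b c := ⟨hc, hbc, hl⟩
    exact absurd (hmin c (hab.tail hd)) (not_le.2 (hd.level_lt hpos))

/-- Among the vertices reached at level at least `t` take a lowest one: it is not the root, and its
parent must be below `t`. -/
theorem exists_descends_crossing (hpos : ∀ e ∈ H.edgeSet, 0 < wt e) (hU : U.Finite) (hrU : r ∈ U)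
    (hr : ∀ x ∈ U, ∃ s, LinkedWithin H wt U s r x) {a : V} (ha : a ∈ U) {t : ℝ} (ht : 0 < t)
    (hta : t ≤ level H wt U r a) :
    ∃ b c, Relation.ReflTransGen (Descends H wt U r) a b ∧ Descends H wt U r b c ∧
      t ≤ level H wt U r b ∧ level H wt U r c < t := by
  obtain ⟨b, ⟨hab, htb⟩, hmin⟩ := Set.exists_min_image
    {b | Relation.ReflTransGen (Descends H wt U r) a b ∧ t ≤ level H wt U r b} (level H wt U r)
    (hU.subset fun b hb => mem_of_descends ha hb.1) ⟨a, .refl, hta⟩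
  have hbr : b ≠ r := by
    rintro rfl
    rw [level_self hpos hrU] at htb
    linarith
  obtain ⟨c, hc, hbc, hl⟩ := exists_parent hpos hU (hr b (mem_of_descends ha hab)) hbr
  have hd : Descends H wt U r b c := ⟨hc, hbc, hl⟩
  refine ⟨b, c, hab, hd, htb, ?_⟩
  by_contra htc
  exact absurd (hmin c ⟨hab.tail hd, not_lt.1 htc⟩) (not_le.2 (hd.level_lt hpos))

end Descent

/-! ### Growing a biclique minor by undoing cuts -/

/-- A `K_{s,m}`-minor within `U`, whose left branch sets `A j` are near prescribed vertices `X j`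
and have a vertex `e j` that is far from the right branch sets `B k` within `U`. -/
structure BicliqueStage {V : Type v} (H : SimpleGraph V) (wt : Sym2 V → ℝ) (δ : ℝ) {s : ℕ}
    (X : Fin s → V) (U : Set V) (m : ℕ) where
  A : Fin s → Set V
  B : ℕ → Set V
  e : Fin s → V
  e_mem : ∀ j, e j ∈ A j
  A_subset : ∀ j, A j ⊆ U
  B_subset : ∀ k < m, B k ⊆ U
  A_connected : ∀ j, (H.induce (A j)).Connected
  B_connected : ∀ k < m, (H.induce (B k)).Connected
  disjoint_A_B : ∀ j, ∀ k < m, Disjoint (A j) (B k)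
  disjoint_B_B : ∀ k < m, ∀ l < m, k ≠ l → Disjoint (B k) (B l)
  adj : ∀ j, ∀ k < m, ∃ a ∈ A j, ∃ b ∈ B k, H.Adj a b
  near : ∀ j, ∀ a ∈ A j, LinkedWithin H wt Set.univ (m * (5 * δ)) (X j) a
  clear : ∀ j x, LinkedWithin H wt U δ (e j) x → ∀ k < m, x ∉ B k

/-- Passing from a piece of a band of levels to the whole graph adds a right branch set. -/
theorem BicliqueStage.extend {V : Type v} {H : SimpleGraph V} {wt : Sym2 V → ℝ} {δ : ℝ} {s : ℕ}
    {X : Fin s → V} {U U' : Set V} {m : ℕ} {r : V} {lo : ℝ}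
    (hpos : ∀ e ∈ H.edgeSet, 0 < wt e) (hshort : ∀ e ∈ H.edgeSet, wt e ≤ δ) (hδ : 0 < δ)
    (hU' : U'.Finite) (hrU : r ∈ U') (hr : ∀ x ∈ U', ∃ s, LinkedWithin H wt U' s r x)
    (hlo : 4 * δ < lo) (hUU' : U ⊆ U')
    (hband : ∀ x ∈ U, lo ≤ level H wt U' r x ∧ level H wt U' r x < lo + δ)
    (hclosed : ∀ a ∈ U, ∀ b ∈ U', H.Adj a b → lo ≤ level H wt U' r b →
      level H wt U' r b < lo + δ → b ∈ U)
    (S : BicliqueStage H wt δ X U m) : Nonempty (BicliqueStage H wt δ X U' (m + 1)) := by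
  classical
  set L := level H wt U' r with hL
  set D := Relation.ReflTransGen (Descends H wt U' r) with hD
  have heU : ∀ j, S.e j ∈ U := fun j => S.A_subset j (S.e_mem j)
  have heU' : ∀ j, S.e j ∈ U' := fun j => hUU' (heU j)
  have hdrop : ∀ a b, D a b → L b ≤ L a := by
    intro a b h
    induction h with
    | refl => exact le_rfl
    | tail _ h ih => exact (h.level_lt hpos).le.trans ih
  have hcross := fun j (t : ℝ) (ht : 0 < t) (hta : t ≤ L (S.e j)) =>
    exists_descends_crossing hpos hU' hrU hr (heU' j) ht hta
  -- Edges have length at most `δ`, so the first vertex below `lo - 2 * δ` is still at level at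
  -- least `lo - 3 * δ`.
  have htail : ∀ j, ∃ e, D (S.e j) e ∧ lo - 3 * δ ≤ L e ∧ L e < lo - 2 * δ := by
    intro j
    obtain ⟨b, c, hb, hbc, h1, h2⟩ := hcross j (lo - 2 * δ) (by linarith)
      (by linarith [(hband _ (heU j)).1])
    refine ⟨c, hb.tail hbc, ?_, h2⟩
    have h3 := level_le_add hpos (hr c hbc.1)
      (LinkedWithin.of_adj (wt := wt) hbc.2.1 (mem_of_descends (heU' j) hb) hbc.1).symm
    have h4 := hshort _ (H.mem_edgeSet.2 hbc.2.1)
    linarith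
  choose e' heD heL heL' using htail
  -- `Q j` is the tail added to `A j`, and the ball `N` around the root is the new right branch set.
  -- The tails stop where `N` begins.
  set Q : Fin s → Set V := fun j => {x | D (S.e j) x ∧ lo - 4 * δ ≤ L x} with hQ
  set N : Set V := {x | x ∈ U' ∧ L x < lo - 4 * δ} with hN
  have hQU' : ∀ j, Q j ⊆ U' := fun j x hx => mem_of_descends (heU' j) hx.1
  have hQlink : ∀ j, ∀ x ∈ Q j, LinkedWithin H wt (Q j) (L (S.e j) - L x) (S.e j) x :=
    fun j x hx => linkedWithin_of_descends hpos hx.1 fun z hz hxz => ⟨hz, hx.2.trans hxz⟩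
  have heQ : ∀ j, S.e j ∈ Q j := fun j => ⟨.refl, by linarith [(hband _ (heU j)).1]⟩
  have hQconn : ∀ j, (H.induce (Q j)).Connected := fun j =>
    connected_of_linkedWithin (heQ j) fun x hx => ⟨_, hQlink j x hx⟩
  have hNU : ∀ x ∈ N, x ∉ U := fun x hx hxU => by linarith [(hband x hxU).1, hx.2]
  -- A vertex of `Q j` in an old `B k` lies in the band, hence so does the descent to it from `S.e
  -- j`. That descent stays in `U` by `hclosed` and is shorter than `δ`, against `S.clear`.
  have hQB : ∀ j, ∀ k < m, Disjoint (Q j) (S.B k) := by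
    intro j k hk
    refine Set.disjoint_left.2 fun x hx hxB => ?_
    have hxU := S.B_subset k hk hxB
    refine S.clear j x ?_ k hk hxB
    have hlink : LinkedWithin H wt {z | D (S.e j) z ∧ L x ≤ L z} (L (S.e j) - L x) (S.e j) x :=
      linkedWithin_of_descends hpos hx.1 fun z hz hxz => ⟨hz, hxz⟩
    refine (hlink.restrict hpos (heU j) fun a ha b hb hab => ?_).mono subset_rfl ?_
    · have hb' := hb.right_mem
      refine hclosed a ha b (mem_of_descends (heU' j) hb'.1) hab ?_ ?_
      · exact (hband x hxU).1.trans hb'.2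
      · exact (hdrop _ _ hb'.1).trans_lt (hband _ (heU j)).2
    · linarith [(hband x hxU).1, (hband _ (heU j)).2]
  refine ⟨⟨fun j => S.A j ∪ Q j, fun k => if k < m then S.B k else N, e', fun j => .inr ⟨heD j, ?_⟩,
    fun j => Set.union_subset ((S.A_subset j).trans hUU') (hQU' j), ?_, fun j => ?_, ?_, ?_, ?_,
    ?_, ?_, ?_⟩⟩
  · linarith [heL j]
  · intro k _
    split_ifs with hk
    · exact (S.B_subset k hk).trans hUU'
    · exact fun x hx => hx.1
  · exact SimpleGraph.induce_union_connected (S.A_connected j).preconnected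
      (hQconn j).preconnected ⟨S.e j, S.e_mem j, heQ j⟩
  · intro k _
    by_cases hk : k < m
    · rw [if_pos hk]
      exact S.B_connected k hk
    · rw [if_neg hk]
      have hrN : r ∈ N := ⟨hrU, by rw [hL, level_self hpos hrU]; linarith⟩
      refine connected_of_linkedWithin hrN fun x hx => ⟨_, LinkedWithin.symm
        (linkedWithin_of_descends hpos (descends_root hpos hU' hr hx.1) fun z hz _ => ⟨?_, ?_⟩)⟩
      · exact mem_of_descends hx.1 hz
      · exact (hdrop _ _ hz).trans_lt hx.2
  · intro j k _
    rw [Set.disjoint_union_left]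
    split_ifs with hk
    · exact ⟨S.disjoint_A_B j k hk, hQB j k hk⟩
    · refine ⟨Set.disjoint_left.2 fun x hx hxN => hNU x hxN (S.A_subset j hx),
        Set.disjoint_left.2 fun x hx hxN => ?_⟩
      linarith [hx.2, hxN.2]
  · intro k hkm l hlm hkl
    have hBN : ∀ k < m, Disjoint (S.B k) N := fun k hk =>
      Set.disjoint_left.2 fun x hx hxN => hNU x hxN (S.B_subset k hk hx)
    split_ifs with hk hl hl
    · exact S.disjoint_B_B k hk l hl hkl
    · exact hBN k hk
    · exact (hBN l hl).symm
    · omega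
  · intro j k _
    split_ifs with hk
    · obtain ⟨a, ha, b, hb, hab⟩ := S.adj j k hk
      exact ⟨a, .inl ha, b, hb, hab⟩
    · obtain ⟨b, c, hb, hbc, h1, h2⟩ := hcross j (lo - 4 * δ) (by linarith)
        (by linarith [(hband _ (heU j)).1])
      exact ⟨b, .inr ⟨hb, h1⟩, c, ⟨hbc.1, h2⟩, hbc.2.1⟩
  · rintro j a (ha | ha)
    · exact (S.near j a ha).mono subset_rfl (by push_cast; linarith)
    -- A tail runs from below `lo + δ` to at least `lo - 4 * δ`, so it adds at most `5 * δ`.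
    · refine ((S.near j _ (S.e_mem j)).trans ((hQlink j a ha).mono (Set.subset_univ _)
        le_rfl)).mono subset_rfl ?_
      push_cast
      linarith [(hband _ (heU j)).2, ha.2]
  -- A vertex within `δ` of `e' j` has level in `[lo - 4 * δ, lo - δ)`: too high for `N` and too low
  -- for the band that holds the old `B k`.
  · intro j x hx k _
    have h1 := abs_le.1 (abs_level_sub_le hpos (hr _ hx.left_mem) hx)
    have h2 := heL j
    have h3 := heL' j
    split_ifs with hk
    · intro hxB
      linarith [(hband x (S.B_subset k hk hxB)).1]
    · intro hxN
      linarith [hxN.2]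

/-! ### Iterated cutting into bands -/

section Cluster

variable {V : Type v} {H : SimpleGraph V} {wt : Sym2 V → ℝ}

/-- The vertices that are joined to `x` by a walk within `S`. -/
def piece (H : SimpleGraph V) (wt : Sym2 V → ℝ) (S : Set V) (x : V) : Set V :=
  {y | ∃ t, LinkedWithin H wt S t x y}

theorem mem_piece_self {S : Set V} {x : V} (hx : x ∈ S) : x ∈ piece H wt S x :=
  ⟨0, .refl hx le_rfl⟩

theorem piece_subset {S : Set V} {x : V} : piece H wt S x ⊆ S :=
  fun _ ⟨_, h⟩ => h.right_mem

theorem piece_eq_of_mem {S : Set V} {x y : V} (h : y ∈ piece H wt S x) :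
    piece H wt S y = piece H wt S x := by
  obtain ⟨t, ht⟩ := h
  ext z
  exact ⟨fun ⟨_, hz⟩ => ⟨_, ht.trans hz⟩, fun ⟨_, hz⟩ => ⟨_, ht.symm.trans hz⟩⟩

theorem LinkedWithin.within_piece (hpos : ∀ e ∈ H.edgeSet, 0 < wt e) {S : Set V} {t : ℝ} {x y : V}
    (h : LinkedWithin H wt S t x y) : LinkedWithin H wt (piece H wt S x) t x y :=
  h.restrict hpos (mem_piece_self h.left_mem) fun _ _ _ hb _ => ⟨t, hb⟩

/-- The index of the band of width `δ` that holds the level `t`, the bands being shifted by half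
their width if `b` is true. -/
noncomputable def band (δ : ℝ) (b : Bool) (t : ℝ) : ℤ :=
  ⌊t / δ + (if b then 1 / 2 else 0)⌋

/-- If `t / δ` has fractional part in `[1/4, 3/4]`, the unshifted band boundaries are at least `δ /
4` away from `t`; otherwise the shifted ones are. -/
theorem exists_band_eq {δ : ℝ} (hδ : 0 < δ) (t : ℝ) :
    ∃ b, ∀ t', |t' - t| < δ / 4 → band δ b t' = band δ b t := by
  have key : ∀ t', |t' - t| < δ / 4 → t / δ - 1 / 4 < t' / δ ∧ t' / δ < t / δ + 1 / 4 := by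
    intro t' h
    rw [abs_lt] at h
    constructor
    · rw [lt_div_iff₀ hδ, sub_mul, div_mul_cancel₀ _ hδ.ne']
      linarith
    · rw [div_lt_iff₀ hδ, add_mul, div_mul_cancel₀ _ hδ.ne']
      linarith
  have h0 := Int.floor_le (t / δ)
  have h1 := Int.lt_floor_add_one (t / δ)
  by_cases hlow : t / δ < ⌊t / δ⌋ + 1 / 4
  · refine ⟨true, fun t' h => ?_⟩
    obtain ⟨h2, h3⟩ := key t' h
    have e1 : band δ true t' = ⌊t / δ⌋ := by
      simp only [band, if_true, Int.floor_eq_iff]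
      constructor <;> linarith
    have e2 : band δ true t = ⌊t / δ⌋ := by
      simp only [band, if_true, Int.floor_eq_iff]
      constructor <;> linarith
    rw [e1, e2]
  by_cases hhigh : t / δ ≤ ⌊t / δ⌋ + 3 / 4
  · refine ⟨false, fun t' h => ?_⟩
    obtain ⟨h2, h3⟩ := key t' h
    have e1 : band δ false t' = ⌊t / δ⌋ := by
      simp only [band, Int.floor_eq_iff]
      exact ⟨by norm_num; linarith, by norm_num; linarith⟩
    have e2 : band δ false t = ⌊t / δ⌋ := by
      simp only [band, Int.floor_eq_iff]
      exact ⟨by norm_num; linarith, by norm_num⟩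
    rw [e1, e2]
  · refine ⟨true, fun t' h => ?_⟩
    obtain ⟨h2, h3⟩ := key t' h
    have e1 : band δ true t' = ⌊t / δ⌋ + 1 := by
      simp only [band, if_true, Int.floor_eq_iff]
      push_cast
      constructor <;> linarith
    have e2 : band δ true t = ⌊t / δ⌋ + 1 := by
      simp only [band, if_true, Int.floor_eq_iff]
      push_cast
      constructor <;> linarith
    rw [e1, e2]

/-- A fixed element of `U` if `U` is nonempty. -/
noncomputable def rootOf (U : Set V) (x : V) : V :=
  @Classical.epsilon V ⟨x⟩ (· ∈ U)

theorem rootOf_mem {U : Set V} {x y : V} (hy : y ∈ U) : rootOf U x ∈ U :=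
  Classical.epsilon_spec (p := (· ∈ U)) ⟨y, hy⟩

/-- Repeatedly, a set is cut into bands of levels with respect to a root of it, and the connected
piece containing `x` of a band is retained. -/
noncomputable def cluster (H : SimpleGraph V) (wt : Sym2 V → ℝ) (δ : ℝ) (U₀ : Set V) :
    List Bool → V → Set V
  | [], x => piece H wt U₀ x
  | b :: l, x =>
    piece H wt {y ∈ cluster H wt δ U₀ l x |
      band δ b (level H wt (cluster H wt δ U₀ l x) (rootOf (cluster H wt δ U₀ l x) x) y) =
        band δ b (level H wt (cluster H wt δ U₀ l x) (rootOf (cluster H wt δ U₀ l x) x) x)} x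

variable {δ : ℝ} {U₀ : Set V} {x y : V}

theorem cluster_cons_subset (b : Bool) (l : List Bool) :
    cluster H wt δ U₀ (b :: l) x ⊆ cluster H wt δ U₀ l x :=
  fun _ h => (piece_subset h).1

theorem cluster_subset (l : List Bool) : cluster H wt δ U₀ l x ⊆ U₀ := by
  induction l with
  | nil => exact piece_subset
  | cons b l ih => exact (cluster_cons_subset b l).trans ih

theorem mem_cluster_self (hx : x ∈ U₀) (l : List Bool) : x ∈ cluster H wt δ U₀ l x := by
  induction l with
  | nil => exact mem_piece_self hx
  | cons b l ih => exact mem_piece_self ⟨ih, rfl⟩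

theorem cluster_eq_of_mem (l : List Bool) (h : y ∈ cluster H wt δ U₀ l x) :
    cluster H wt δ U₀ l y = cluster H wt δ U₀ l x := by
  induction l with
  | nil => exact piece_eq_of_mem h
  | cons b l ih =>
    have hU := ih (cluster_cons_subset b l h)
    have hb := (piece_subset h).2
    -- The second argument of `rootOf` enters only through a proof that `V` is nonempty, so proof
    -- irrelevance makes the root depend on the set alone.
    have hroot : rootOf (cluster H wt δ U₀ l x) y = rootOf (cluster H wt δ U₀ l x) x := rfl
    have := piece_eq_of_mem h
    rw [cluster, cluster, hU, hroot, hb, this]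

theorem exists_linkedWithin_cluster (hpos : ∀ e ∈ H.edgeSet, 0 < wt e) (l : List Bool)
    (h : y ∈ cluster H wt δ U₀ l x) : ∃ t, LinkedWithin H wt (cluster H wt δ U₀ l x) t x y := by
  cases l with
  | nil =>
    obtain ⟨t, ht⟩ := h
    exact ⟨t, ht.within_piece hpos⟩
  | cons b l =>
    obtain ⟨t, ht⟩ := h
    exact ⟨t, ht.within_piece hpos⟩

/-- The pieces of the last cut are connected to their root. -/
theorem exists_linkedWithin_root (hpos : ∀ e ∈ H.edgeSet, 0 < wt e) (hx : x ∈ U₀) (l : List Bool)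
    (h : y ∈ cluster H wt δ U₀ l x) :
    ∃ t, LinkedWithin H wt (cluster H wt δ U₀ l x) t (rootOf (cluster H wt δ U₀ l x) x) y := by
  obtain ⟨t, ht⟩ := exists_linkedWithin_cluster hpos l h
  obtain ⟨t', ht'⟩ := exists_linkedWithin_cluster hpos l
    (rootOf_mem (x := x) (mem_cluster_self hx l))
  exact ⟨_, ht'.symm.trans ht⟩

/-- For each vertex some choice of shifts avoids cutting the walks of length less than `δ / 4`. -/
theorem exists_cluster_padded (hpos : ∀ e ∈ H.edgeSet, 0 < wt e) (hδ : 0 < δ) (hx : x ∈ U₀)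
    (n : ℕ) : ∃ l : List Bool, l.length = n ∧ ∀ t y, t < δ / 4 → LinkedWithin H wt U₀ t x y →
      LinkedWithin H wt (cluster H wt δ U₀ l x) t x y := by
  induction n with
  | zero => exact ⟨[], rfl, fun t y _ h => h.within_piece hpos⟩
  | succ n ih =>
    obtain ⟨l, hl, hlink⟩ := ih
    obtain ⟨b, hb⟩ := exists_band_eq hδ
      (level H wt (cluster H wt δ U₀ l x) (rootOf (cluster H wt δ U₀ l x) x) x)
    refine ⟨b :: l, by simp [hl], fun t y ht h => LinkedWithin.within_piece hpos
      ((hlink t y ht h).restrict hpos ⟨mem_cluster_self hx l, rfl⟩ fun a _ z hz _ =>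
        ⟨hz.right_mem, hb _ ?_⟩)⟩
    rw [abs_sub_comm]
    exact (abs_level_sub_le hpos (exists_linkedWithin_root hpos hx l (mem_cluster_self hx l))
      hz).trans_lt ht

/-- The head of the list is the last cut, so induction on the list undoes the latest cut first.
Having both `x` and the distant `y` in the cluster keeps every band away from its root, as
`BicliqueStage.extend` needs. -/
theorem BicliqueStage.of_cluster {s : ℕ} {X : Fin s → V} (hpos : ∀ e ∈ H.edgeSet, 0 < wt e)
    (hshort : ∀ e ∈ H.edgeSet, wt e ≤ δ) (hδ : 0 < δ) (hU₀ : U₀.Finite) (hx : x ∈ U₀)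
    (hxy : ¬ LinkedWithin H wt Set.univ (10 * δ) x y) (l : List Bool)
    (hy : y ∈ cluster H wt δ U₀ l x) (m : ℕ)
    (S : Nonempty (BicliqueStage H wt δ X (cluster H wt δ U₀ l x) m)) :
    Nonempty (BicliqueStage H wt δ X (cluster H wt δ U₀ [] x) (m + l.length)) := by
  induction l generalizing m with
  | nil => exact S
  | cons b l ih =>
    rw [List.length_cons, show m + (l.length + 1) = m + 1 + l.length by ring]
    refine ih (cluster_cons_subset b l hy) (m + 1) ?_
    obtain ⟨S⟩ := S
    set U' := cluster H wt δ U₀ l x with hU'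
    set L := level H wt U' (rootOf U' x) with hL
    set k := band δ b (L x) with hk
    set c : ℝ := if b then 1 / 2 else 0 with hc
    have hroot : ∀ z ∈ U', ∃ t, LinkedWithin H wt U' t (rootOf U' x) z := fun z hz =>
      exists_linkedWithin_root hpos hx l hz
    have hiff : ∀ z, band δ b (L z) = k ↔ δ * (k - c) ≤ L z ∧ L z < δ * (k - c) + δ := by
      intro z
      have : L z = δ * (L z / δ) := by field_simp
      rw [band, Int.floor_eq_iff]
      constructor
      · rintro ⟨h1, h2⟩
        rw [this]
        constructor <;> nlinarith
      · rintro ⟨h1, h2⟩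
        rw [this] at h1 h2
        constructor
        · have := le_of_mul_le_mul_left h1 hδ
          linarith
        · have : δ * (L z / δ) < δ * (k - c + 1) := by linarith
          have := lt_of_mul_lt_mul_left this hδ.le
          linarith
    have hband : ∀ z ∈ cluster H wt δ U₀ (b :: l) x,
        δ * (k - c) ≤ L z ∧ L z < δ * (k - c) + δ := fun z hz => (hiff z).1 (piece_subset hz).2
    refine S.extend hpos hshort hδ (hU₀.subset (cluster_subset l))
      (rootOf_mem (mem_cluster_self hx l)) hroot (lo := δ * (k - c)) ?_
      (cluster_cons_subset b l) hband ?_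
    -- A band starting at `4 * δ` or lower lies within `5 * δ` of the root, which would put `x` and
    -- `y` within `10 * δ`.
    · by_contra hlo
      have hnear : ∀ z ∈ cluster H wt δ U₀ (b :: l) x,
          LinkedWithin H wt U' (5 * δ) (rootOf U' x) z := by
        intro z hz
        have h1 : L z < 5 * δ := by linarith [(hband z hz).2]
        obtain ⟨t, ht, ht'⟩ := exists_lt_of_csInf_lt (hroot z (cluster_cons_subset b l hz)) h1
        exact LinkedWithin.mono ht subset_rfl ht'.le
      exact hxy (((hnear x (mem_cluster_self hx _)).symm.trans (hnear y hy)).mono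
        (Set.subset_univ _) (by linarith))
    · intro a ha z hz haz h1 h2
      have hz' := (hiff z).2 ⟨h1, h2⟩
      obtain ⟨t, ht⟩ := ha
      exact ⟨_, ht.trans (.of_adj haz ht.right_mem ⟨hz, hz'⟩)⟩

/-- A cluster obtained by cutting `s` times is small, unless there is a `K_{s,s}`-minor. -/
theorem linkedWithin_of_mem_cluster {s : ℕ} (hs : 1 ≤ s)
    (hminor : ¬ IsMinor (completeBipartiteGraph (Fin s) (Fin s)) H)
    (hpos : ∀ e ∈ H.edgeSet, 0 < wt e)
    (hshort : ∀ e ∈ H.edgeSet, wt e ≤ δ) (hδ : 0 < δ) (hU₀ : U₀.Finite) (hx : x ∈ U₀)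
    (l : List Bool) (hl : l.length = s) (hy : y ∈ cluster H wt δ U₀ l x) :
    LinkedWithin H wt Set.univ (11 * s ^ 2 * δ) x y := by
  by_contra hxy
  apply hminor
  have hs' : (1 : ℝ) ≤ s := by exact_mod_cast hs
  -- Branch sets stray at most `5 * s * δ` from their centres, and a centre overshoots its threshold
  -- by at most `δ`; spacing `10 * s * δ + δ ≤ R` keeps them disjoint. The `s` thresholds `j * R`
  -- lie below `11 * s ^ 2 * δ`, so a walk from `x` to `y` in the cluster crosses them all.
  set R : ℝ := 11 * s * δ with hR
  have hRpos : 0 ≤ R := by positivity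
  obtain ⟨t, p, hp, -⟩ := exists_linkedWithin_cluster hpos l hy
  have hX : ∀ j : Fin s, ∃ z ∈ cluster H wt δ U₀ l x,
      LinkedWithin H wt Set.univ (j * R + δ) x z ∧ ¬ LinkedWithin H wt Set.univ (j * R) x z := by
    intro j
    have hjs : (j : ℝ) ≤ s := by exact_mod_cast j.2.le
    obtain ⟨a, ha, b, hb, hab, h1, h2⟩ := exists_adj_crossing
      (P := fun z => LinkedWithin H wt Set.univ (j * R) x z) p
      (.refl trivial (by positivity)) (fun h => hxy (h.mono subset_rfl (by
        rw [hR]; nlinarith [mul_le_mul_of_nonneg_right hjs hRpos])))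
    refine ⟨b, hp b hb, (h1.trans (.of_adj hab trivial trivial)).mono subset_rfl ?_, h2⟩
    linarith [hshort _ (H.mem_edgeSet.2 hab)]
  choose X hXU hXnear hXfar using hX
  have hpair_lt : ∀ i j : Fin s, i < j →
      ¬ LinkedWithin H wt Set.univ (2 * (s * (5 * δ))) (X i) (X j) := by
    intro i j hij h
    refine hXfar j (((hXnear i).trans h).mono subset_rfl ?_)
    have hij' : (i : ℝ) + 1 ≤ j := by exact_mod_cast hij
    have := mul_le_mul_of_nonneg_right hij' hRpos
    nlinarith
  have hpair : ∀ i j : Fin s, i ≠ j →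
      ¬ LinkedWithin H wt Set.univ (2 * (s * (5 * δ))) (X i) (X j) := by
    intro i j hij h
    rcases lt_or_gt_of_ne hij with h' | h'
    exacts [hpair_lt _ _ h' h, hpair_lt _ _ h' h.symm]
  have hstart : Nonempty (BicliqueStage H wt δ X (cluster H wt δ U₀ l x) 0) :=
    ⟨{ A := fun j => {X j}
       B := fun _ => ∅
       e := X
       e_mem := fun j => rfl
       A_subset := fun j => by simpa using hXU j
       B_subset := fun k hk => absurd hk (Nat.not_lt_zero _)
       A_connected := fun j => connected_of_linkedWithin (wt := wt) (x := X j) rfl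
        fun y hy => ⟨0, by rw [Set.mem_singleton_iff] at hy; subst hy; exact .refl rfl le_rfl⟩
       B_connected := fun k hk => absurd hk (Nat.not_lt_zero _)
       disjoint_A_B := fun j k hk => absurd hk (Nat.not_lt_zero _)
       disjoint_B_B := fun k hk => absurd hk (Nat.not_lt_zero _)
       adj := fun j k hk => absurd hk (Nat.not_lt_zero _)
       near := fun j a ha => by
        rw [Set.mem_singleton_iff] at ha
        subst ha
        exact .refl trivial (by simp)
       clear := fun j x _ k hk => absurd hk (Nat.not_lt_zero _) }⟩
  obtain ⟨S⟩ := BicliqueStage.of_cluster hpos hshort hδ hU₀ hx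
    (fun h => hxy (h.mono subset_rfl (by nlinarith [mul_pos hδ hδ, one_le_pow₀ (n := 2) hs'])))
    l hy 0 hstart
  rw [hl, zero_add] at S
  have hAA : ∀ i j : Fin s, i ≠ j → Disjoint (S.A i) (S.A j) := by
    intro i j hij
    refine Set.disjoint_left.2 fun a hai haj => hpair i j hij ?_
    exact ((S.near i a hai).trans (S.near j a haj).symm).mono subset_rfl (by linarith)
  refine ⟨Sum.elim S.A fun k => S.B k, ?_, ?_, ?_⟩
  · rintro (j | k)
    exacts [S.A_connected j, S.B_connected k k.2]
  · rintro (i | k) (j | k') hne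
    · exact hAA i j fun h => hne (by rw [h])
    · exact S.disjoint_A_B i k' k'.2
    · exact (S.disjoint_A_B j k k.2).symm
    · exact S.disjoint_B_B k k.2 k' k'.2 fun h => hne (by rw [Fin.ext h])
  · rintro (i | k) (j | k') hadj
    · simp at hadj
    · exact S.adj i k' k'.2
    · obtain ⟨a, ha, b, hb, hab⟩ := S.adj j k k.2
      exact ⟨b, hb, a, ha, hab.symm⟩
    · simp at hadj

end Cluster

/-! ### Padded partitions of the metric space, and the cases of small `s` -/

theorem IsMinor.mono {W : Type w} {V : Type v} {K : SimpleGraph W} {H G : SimpleGraph V}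
    (hHG : H ≤ G) (h : IsMinor K H) : IsMinor K G := by
  obtain ⟨B, hB, hdisj, hadj⟩ := h
  refine ⟨B, fun a => (hB a).mono (SimpleGraph.comap_monotone _ hHG), hdisj, fun a b hab => ?_⟩
  obtain ⟨x, hx, y, hy, hxy⟩ := hadj a b hab
  exact ⟨x, hx, y, hy, hHG hxy⟩

/-- A metric space that excludes `K_{s,s}` as a minor has `2 ^ s` partitions into sets of diameter
`O(s ^ 2 * ρ)` such that every ball of radius `ρ` is contained in a set of one of the
partitions. -/
theorem ExcludesBicliqueMinor.exists_padded_partitions {X : Type u} [MetricSpace X] [Finite X]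
    {s : ℕ} (hs : 1 ≤ s) (hX : ExcludesBicliqueMinor.{u, v} X s) {ρ : ℝ} (hρ : 0 < ρ) :
    ∃ E : List.Vector Bool s → Setoid X,
      (∀ l x y, E l x y → dist x y ≤ 88 * s ^ 2 * ρ) ∧
      ∀ x, ∃ l, ∀ y, dist x y < ρ → E l x y := by
  obtain ⟨V, G, wt, ι, hpos, hminor, hglb⟩ := hX
  have hwalk : ∀ x y : X, ∃ p : G.Walk (ι x) (ι y), x ≠ y → walkLength wt p < 2 * dist x y := by
    intro x y
    by_cases hxy : x = y
    · subst hxy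
      exact ⟨.nil, fun h => absurd rfl h⟩
    · by_contra! h
      have hle : 2 * dist x y ≤ dist x y := (hglb x y).2 (by
        rintro _ ⟨p, rfl⟩
        exact (h p).2)
      linarith [dist_pos.2 hxy]
  choose p hp using hwalk
  -- The graph may be infinite and distances need not be attained; finitely many nearly shortest
  -- walks suffice, and finiteness of `U₀` makes shortest paths inside it exist.
  set U₀ : Set V := ⋃ x, ⋃ y, {z | z ∈ (p x y).support} with hU₀
  have hfin : U₀.Finite := Set.finite_iUnion fun x => Set.finite_iUnion fun y =>
    (p x y).support.finite_toSet
  have hpU : ∀ x y, ∀ z ∈ (p x y).support, z ∈ U₀ := fun x y z hz =>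
    Set.mem_iUnion.2 ⟨x, Set.mem_iUnion.2 ⟨y, hz⟩⟩
  have hιU : ∀ x, ι x ∈ U₀ := fun x => hpU x x _ (p x x).start_mem_support
  -- Dropping long edges makes bands of width `δ = 8 * ρ` effective. Pairs at distance less than `ρ`
  -- keep their chosen walk, of length below `2 * ρ = δ / 4`; walks of `H` still bound `dist` from
  -- above.
  let H : SimpleGraph V :=
    { Adj := fun a b => G.Adj a b ∧ wt s(a, b) < 2 * ρ
      symm := ⟨fun a b h => ⟨h.1.symm, by rw [Sym2.eq_swap]; exact h.2⟩⟩
      loopless := ⟨fun a h => G.loopless.irrefl a h.1⟩ }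
  have hHG : H ≤ G := fun a b h => h.1
  have hposH : ∀ e ∈ H.edgeSet, 0 < wt e := fun e he => hpos e (SimpleGraph.edgeSet_mono hHG he)
  have hmem : ∀ e, e ∈ H.edgeSet ↔ e ∈ G.edgeSet ∧ wt e < 2 * ρ := by
    intro e
    induction e with
    | _ a b => rfl
  have hshort : ∀ e ∈ H.edgeSet, wt e ≤ 8 * ρ := fun e he => by linarith [((hmem e).1 he).2]
  have hdist : ∀ x y t, LinkedWithin H wt Set.univ t (ι x) (ι y) → dist x y ≤ t := by
    rintro x y t ⟨r, -, hr⟩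
    refine le_trans ((hglb x y).1 ⟨r.mapLe hHG, rfl⟩) (le_trans (le_of_eq ?_) hr)
    simp [walkLength]
  refine ⟨fun l => Setoid.comap ι ⟨fun a b => cluster H wt (8 * ρ) U₀ l.1 a =
    cluster H wt (8 * ρ) U₀ l.1 b, ⟨fun _ => rfl, Eq.symm, Eq.trans⟩⟩, ?_, ?_⟩
  · intro l x y h
    have hy : ι y ∈ cluster H wt (8 * ρ) U₀ l.1 (ι x) := by
      rw [show cluster H wt (8 * ρ) U₀ l.1 (ι x) = cluster H wt (8 * ρ) U₀ l.1 (ι y) from h]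
      exact mem_cluster_self (hιU y) _
    have := hdist x y _ (linkedWithin_of_mem_cluster hs (fun h => hminor (h.mono hHG)) hposH hshort
      (by linarith) hfin (hιU x) l.1 l.2 hy)
    linarith
  · intro x
    obtain ⟨l, hl, hpad⟩ := exists_cluster_padded (δ := 8 * ρ) hposH (by linarith) (hιU x) s
    refine ⟨⟨l, hl⟩, fun y hxy => ?_⟩
    by_cases hne : x = y
    · subst hne
      exact rfl
    have hlen : walkLength wt (p x y) < 2 * ρ := by linarith [hp x y hne]
    have hedge : ∀ e ∈ (p x y).edges, e ∈ H.edgeSet := fun e he => (hmem e).2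
      ⟨(p x y).edges_subset_edgeSet he, (le_walkLength_of_mem_edges hpos _ he).trans_lt hlen⟩
    have hlink : LinkedWithin H wt U₀ (walkLength wt (p x y)) (ι x) (ι y) :=
      ⟨(p x y).transfer H hedge, by simpa using hpU x y, le_of_eq (by simp [walkLength])⟩
    exact (cluster_eq_of_mem l (hpad _ _ (by linarith) hlink).right_mem).symm

/-- A metric space with `K_{1,1}` excluded has at most one point. -/
theorem ExcludesBicliqueMinor.subsingleton {X : Type u} [MetricSpace X]
    (hX : ExcludesBicliqueMinor.{u, v} X 1) : Subsingleton X := by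
  obtain ⟨V, G, wt, ι, hpos, hminor, hglb⟩ := hX
  refine ⟨fun x y => ?_⟩
  by_contra hxy
  have hp : Nonempty (G.Walk (ι x) (ι y)) := by
    by_contra hempty
    -- Without walks every real is a lower bound of the empty range, so none is greatest.
    rw [not_nonempty_iff] at hempty
    have : dist x y + 1 ≤ dist x y :=
      (hglb x y).2 (by rintro _ ⟨p, -⟩; exact (hempty.false p).elim)
    linarith
  obtain ⟨p⟩ := hp
  obtain ⟨a, -, b, -, hab, -⟩ := exists_adj_crossing (P := fun z => z = ι x) p rfl
    (fun h => hxy (ι.injective h.symm))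
  have hsingle : ∀ c : V, (G.induce {c}).Connected := fun c =>
    connected_of_linkedWithin (wt := wt) (x := c) rfl fun y hy =>
      ⟨0, by rw [Set.mem_singleton_iff] at hy; subst hy; exact .refl rfl le_rfl⟩
  refine hminor ⟨Sum.elim (fun _ => {a}) (fun _ => {b}), ?_, ?_, ?_⟩
  · rintro (i | i)
    exacts [hsingle a, hsingle b]
  · rintro (i | i) (j | j) hij
    · exact absurd (congrArg Sum.inl (Subsingleton.elim i j)) hij
    · simpa using hab.ne
    · simpa using hab.ne'
    · exact absurd (congrArg Sum.inr (Subsingleton.elim i j)) hij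
  · rintro (i | i) (j | j) hij
    · simp at hij
    · exact ⟨a, rfl, b, rfl, hab⟩
    · exact ⟨b, rfl, a, rfl, hab.symm⟩
    · simp at hij

/-- `K_{0,0}` has no vertices, so it is a minor of every graph. -/
theorem ExcludesBicliqueMinor.ne_zero {X : Type u} [MetricSpace X] {s : ℕ}
    (hX : ExcludesBicliqueMinor.{u, v} X s) : s ≠ 0 := by
  rintro rfl
  obtain ⟨V, G, wt, ι, hpos, hminor, hglb⟩ := hX
  refine hminor ⟨fun _ => ∅, ?_, ?_, ?_⟩
  all_goals
    rintro (i | i)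
    all_goals exact i.elim0

/-! ### Making the partitions nested -/

section Hierarchy

variable {X : Type u}

/-- The points `x` and `y` agree at index `i` if their `i`-th representatives coincide, where the
`i`-th representative of a point is that of the `E i`-class of its representative before. -/
noncomputable def representative (E : ℕ → Setoid X) : ℕ → X → X
  | 0, x => x
  | i + 1, x => (Quotient.mk (E (i + 1)) (representative E i x)).out

variable {E : ℕ → Setoid X}

theorem representative_succ_eq {i : ℕ} {x y : X} :
    representative E (i + 1) x = representative E (i + 1) y ↔
      E (i + 1) (representative E i x) (representative E i y) := by
  rw [representative, representative, Quotient.out_inj, Quotient.eq]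

theorem representative_nested {i : ℕ} {x y : X} (h : representative E i x = representative E i y) :
    representative E (i + 1) x = representative E (i + 1) y := by
  rw [representative, representative, h]

variable [MetricSpace X] {ρ : ℕ → ℝ} {K : ℝ}

/-- The scales grow so fast that the drift accumulated before step `i + 1` is at most `ρ (i + 1) /
2`, so the last move dominates. -/
theorem dist_representative_le (hK : 1 ≤ K) (hρ : ∀ i, 0 < ρ i)
    (hgrow : ∀ i, 4 * K * ρ i ≤ ρ (i + 1)) (hE : ∀ i x y, E i x y → dist x y ≤ K * ρ i)
    (i : ℕ) (x : X) : dist x (representative E i x) ≤ 2 * K * ρ i := by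
  induction i with
  | zero =>
    rw [representative, dist_self]
    have := hρ 0
    positivity
  | succ i ih =>
    have h1 := hE (i + 1) _ _
      ((E (i + 1)).symm' (Quotient.mk_out (s := E (i + 1)) (representative E i x)))
    have h2 := dist_triangle x (representative E i x) (representative E (i + 1) x)
    have h3 : ρ (i + 1) ≤ K * ρ (i + 1) := le_mul_of_one_le_left (hρ _).le hK
    have h4 := hgrow i
    rw [show representative E (i + 1) x = (Quotient.mk (E (i + 1)) (representative E i x)).out from
      rfl] at h2 ⊢
    linarith [hρ (i + 1)]

theorem dist_le_of_representative_eq (hK : 1 ≤ K) (hρ : ∀ i, 0 < ρ i)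
    (hgrow : ∀ i, 4 * K * ρ i ≤ ρ (i + 1)) (hE : ∀ i x y, E i x y → dist x y ≤ K * ρ i)
    {i : ℕ} {x y : X} (h : representative E i x = representative E i y) :
    dist x y ≤ 4 * K * ρ i := by
  have h1 := dist_representative_le hK hρ hgrow hE i x
  have h2 := dist_representative_le hK hρ hgrow hE i y
  have h3 := dist_triangle_right x y (representative E i x)
  rw [← h] at h2
  linarith

/-- Drift uses at most half of the padding radius: the previous representatives of `x` and `y` still
lie in the ball of radius `ρ (i + 1)` around `x`. -/
theorem representative_eq_of_padded (hK : 1 ≤ K) (hρ : ∀ i, 0 < ρ i)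
    (hgrow : ∀ i, 4 * K * ρ i ≤ ρ (i + 1)) (hE : ∀ i x y, E i x y → dist x y ≤ K * ρ i)
    {i : ℕ} {x : X} (hx : ∀ y, dist x y < ρ (i + 1) → E (i + 1) x y) {y : X}
    (hy : dist x y < ρ (i + 1) / 2) :
    representative E (i + 1) y = representative E (i + 1) x := by
  have h1 := dist_representative_le hK hρ hgrow hE i
  have h2 := hgrow i
  have h3 := hρ (i + 1)
  rw [representative_succ_eq]
  refine (E (i + 1)).trans' ((E (i + 1)).symm' (hx _ ?_)) (hx _ ?_)
  · have := h1 y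
    have := dist_triangle x y (representative E i y)
    linarith
  · have := h1 x
    linarith

end Hierarchy

/-! ### An order making all classes intervals, and dyadic blocks -/

section Order

/-- The key is a number in base `n` with digits `idx (q i x)`, the finest class being the lowest
digit. Division by `n ^ i` erases the finer digits, and nestedness makes the remaining ones agree
once digit `i` does. -/
theorem exists_key {X : Type u} {n : ℕ} (idx : X ≃ Fin n) (N : ℕ) (q : ℕ → X → X)
    (hq : ∀ i x y, q i x = q i y → q (i + 1) x = q (i + 1) y) :
    ∃ key : X → ℕ, ∀ i ≤ N, ∀ x y, q i x = q i y ↔ key x / n ^ i = key y / n ^ i := by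
  induction N generalizing q with
  | zero =>
    refine ⟨fun x => idx (q 0 x), fun i hi x y => ?_⟩
    obtain rfl := Nat.le_zero.1 hi
    simp [Fin.val_inj]
  | succ N ih =>
    obtain ⟨key, hkey⟩ := ih (fun i => q (i + 1)) fun i => hq (i + 1)
    have hdiv : ∀ x, (n * key x + idx (q 0 x)) / n = key x := fun x => by
      have hlt := (idx (q 0 x)).2
      rw [Nat.mul_add_div (by omega), Nat.div_eq_of_lt hlt, add_zero]
    have hmod : ∀ x, (n * key x + idx (q 0 x)) % n = idx (q 0 x) := fun x => by
      rw [Nat.mul_add_mod, Nat.mod_eq_of_lt (idx (q 0 x)).2]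
    refine ⟨fun x => n * key x + idx (q 0 x), fun i hi x y => ?_⟩
    cases i with
    | zero =>
      simp only [pow_zero, Nat.div_one]
      constructor
      · intro h
        have := (hkey 0 (Nat.zero_le _) x y).1 (hq 0 x y h)
        simp only [pow_zero, Nat.div_one] at this
        rw [h, this]
      · intro h
        have := congrArg (· % n) h
        simp only [hmod] at this
        exact idx.injective (Fin.ext this)
    | succ i =>
      rw [pow_succ', ← Nat.div_div_eq_div_mul, ← Nat.div_div_eq_div_mul, hdiv, hdiv]
      exact hkey i (by omega) x y

/-- The points of a finite set can be ordered such that the classes of a nested sequence of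
partitions are intervals. -/
theorem exists_convex_order {X : Type u} [Fintype X] (N : ℕ) (q : ℕ → X → X)
    (hq : ∀ i x y, q i x = q i y → q (i + 1) x = q (i + 1) y) (hq0 : Function.Injective (q 0)) :
    ∃ pos : X ≃ Fin (Fintype.card X), ∀ i ≤ N, ∀ x y z, pos x ≤ pos y → pos y ≤ pos z →
      q i x = q i z → q i y = q i x := by
  obtain ⟨key, hkey⟩ := exists_key (Fintype.equivFin X) N q hq
  have hinj : Function.Injective key := fun x y h =>
    hq0 ((hkey 0 (Nat.zero_le _) x y).2 (by rw [h]))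
  let _ : LinearOrder X := LinearOrder.lift' key hinj
  have hle : ∀ x y : X, x ≤ y ↔ key x ≤ key y := fun _ _ => Iff.rfl
  refine ⟨(Fintype.orderIsoFinOfCardEq X rfl).symm.toEquiv, fun i hi x y z hxy hyz hxz => ?_⟩
  have hxy' := (hle x y).1 ((Fintype.orderIsoFinOfCardEq X rfl).symm.le_iff_le.1 hxy)
  have hyz' := (hle y z).1 ((Fintype.orderIsoFinOfCardEq X rfl).symm.le_iff_le.1 hyz)
  have h := (hkey i hi x z).1 hxz
  rw [hkey i hi]
  exact le_antisymm (h ▸ Nat.div_le_div_right hyz') (Nat.div_le_div_right hxy')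

/-- Two distinct numbers lie in the two halves of some dyadic block. -/
theorem exists_dyadic_separation {a b : ℕ} (h : a < b) :
    ∃ t, a / 2 ^ (t + 1) = b / 2 ^ (t + 1) ∧ a / 2 ^ t = 2 * (b / 2 ^ (t + 1)) ∧
      b / 2 ^ t = 2 * (b / 2 ^ (t + 1)) + 1 := by
  have hex : ∃ t, a / 2 ^ t = b / 2 ^ t := ⟨b, by
    rw [Nat.div_eq_of_lt (h.trans Nat.lt_two_pow_self), Nat.div_eq_of_lt Nat.lt_two_pow_self]⟩
  classical
  cases hT : Nat.find hex with
  | zero =>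
    have := Nat.find_spec hex
    rw [hT] at this
    simp only [pow_zero, Nat.div_one] at this
    omega
  | succ t =>
    have h1 := Nat.find_spec hex
    have h2 := Nat.find_min hex (m := t) (by omega)
    rw [hT] at h1
    have h3 : a / 2 ^ t ≤ b / 2 ^ t := Nat.div_le_div_right h.le
    refine ⟨t, h1, ?_⟩
    rw [pow_succ, ← Nat.div_div_eq_div_mul, ← Nat.div_div_eq_div_mul] at h1
    rw [pow_succ, ← Nat.div_div_eq_div_mul]
    omega

end Order

/-! ### Distance to the boundary of a class -/

section DistCompl

variable {X : Type u} [MetricSpace X]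

open Classical in
/-- The distance from `x` to the complement of `C`, where `T` stands for infinity. -/
noncomputable def distCompl (T : ℝ) (C : Set X) (x : X) : ℝ :=
  ⨅ y, if y ∈ C then T else dist x y

variable {T : ℝ} {C : Set X} {x y : X}

theorem distCompl_nonneg (hT : 0 ≤ T) : 0 ≤ distCompl T C x :=
  Real.iInf_nonneg fun y => by split_ifs; exacts [hT, dist_nonneg]

theorem le_distCompl {τ : ℝ} (hτT : τ ≤ T) (h : ∀ y, dist x y < τ → y ∈ C) :
    τ ≤ distCompl T C x := by
  have : Nonempty X := ⟨x⟩
  refine le_ciInf fun y => ?_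
  split_ifs with hy
  · exact hτT
  · exact not_lt.1 fun hlt => hy (h y hlt)

variable [Finite X]

theorem distCompl_le (hy : y ∉ C) : distCompl T C x ≤ dist x y :=
  (ciInf_le (Set.finite_range _).bddBelow y).trans (by rw [if_neg hy])

theorem distCompl_le_add : distCompl T C x ≤ distCompl T C y + dist x y := by
  have : Nonempty X := ⟨x⟩
  rw [← sub_le_iff_le_add]
  refine le_ciInf fun z => ?_
  have h := ciInf_le (f := fun z => @ite _ (z ∈ C) (Classical.propDecidable _) T (dist x z))
    (Set.finite_range _).bddBelow z
  change distCompl T C x ≤ _ at h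
  split_ifs at h ⊢ with hz
  · linarith [dist_nonneg (x := x) (y := y)]
  · linarith [dist_triangle x y z]

theorem abs_distCompl_sub_le : |distCompl T C x - distCompl T C y| ≤ dist x y := by
  rw [abs_sub_le_iff]
  constructor
  · linarith [distCompl_le_add (T := T) (C := C) (x := x) (y := y)]
  · linarith [distCompl_le_add (T := T) (C := C) (x := y) (y := x), dist_comm x y]

/-- Functions that are Lipschitz on the sets of a partition and vanish on their boundaries are
Lipschitz. -/
theorem abs_sub_le_of_partition {Q : X → Set X} (hself : ∀ x, x ∈ Q x)
    (hQ : ∀ x y, y ∈ Q x → Q y = Q x) {F : X → ℝ} (hbd : ∀ x, |F x| ≤ distCompl T (Q x) x)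
    (hF : ∀ x y, y ∈ Q x → |F x - F y| ≤ dist x y) (x y : X) : |F x - F y| ≤ 2 * dist x y := by
  by_cases hy : y ∈ Q x
  · linarith [hF x y hy, dist_nonneg (x := x) (y := y)]
  · have hx : x ∉ Q y := fun h => hy (hQ y x h ▸ hself y)
    have h1 := (hbd x).trans (distCompl_le hy)
    have h2 := (hbd y).trans (distCompl_le hx)
    rw [dist_comm] at h2
    linarith [abs_sub (F x) (F y)]

end DistCompl

/-! ### Maximal classes inside dyadic blocks -/

section Blocks

variable {X : Type u} (q : ℕ → X → X) (pos : X → ℕ) (N : ℕ)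

/-- The class of `x` at index `i` lies in one dyadic block of length `2 ^ t`. -/
def InBlock (t i : ℕ) (x : X) : Prop :=
  ∀ y, q i y = q i x → pos y / 2 ^ t = pos x / 2 ^ t

open Classical in
/-- The largest class of `x` that lies in a dyadic block of length `2 ^ t`. -/
noncomputable def blockClass (t : ℕ) (x : X) : Set X :=
  {y | q (Nat.findGreatest (fun i => InBlock q pos t i x) N) y =
    q (Nat.findGreatest (fun i => InBlock q pos t i x) N) x}

variable {q pos N}

theorem mem_blockClass_self (t : ℕ) (x : X) : x ∈ blockClass q pos N t x := by
  rw [blockClass]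
  exact rfl

theorem nested_of_le (hq : ∀ i x y, q i x = q i y → q (i + 1) x = q (i + 1) y) {i j : ℕ}
    (hij : i ≤ j) {x y : X} (h : q i x = q i y) : q j x = q j y := by
  induction hij with
  | refl => exact h
  | step _ ih => exact hq _ _ _ ih

open Classical in
theorem inBlock_findGreatest (hq0 : Function.Injective (q 0)) (t : ℕ) (x : X) :
    InBlock q pos t (Nat.findGreatest (fun i => InBlock q pos t i x) N) x :=
  Nat.findGreatest_spec (P := fun i => InBlock q pos t i x) (Nat.zero_le N)
    (fun y hy => by rw [hq0 hy])

theorem div_eq_of_mem_blockClass (hq0 : Function.Injective (q 0)) {t : ℕ} {x y : X}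
    (h : y ∈ blockClass q pos N t x) : pos y / 2 ^ t = pos x / 2 ^ t :=
  inBlock_findGreatest hq0 t x y h

theorem class_subset_blockClass (hq : ∀ i x y, q i x = q i y → q (i + 1) x = q (i + 1) y)
    {t i : ℕ} (hi : i ≤ N) {x y : X} (hx : InBlock q pos t i x) (h : q i y = q i x) :
    y ∈ blockClass q pos N t x := by
  classical
  exact nested_of_le hq (Nat.le_findGreatest (P := fun i => InBlock q pos t i x) hi hx) h

/-- Members of a class share its block, so the same indices qualify for `x` and for `y` and the
greatest ones agree. Hence these sets form a partition. -/
theorem blockClass_eq_of_mem (hq : ∀ i x y, q i x = q i y → q (i + 1) x = q (i + 1) y)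
    (hq0 : Function.Injective (q 0)) {t : ℕ} {x y : X} (h : y ∈ blockClass q pos N t x) :
    blockClass q pos N t y = blockClass q pos N t x := by
  classical
  have hxd := inBlock_findGreatest (pos := pos) (N := N) hq0 t x
  have hyd := inBlock_findGreatest (pos := pos) (N := N) hq0 t y
  have hblock := div_eq_of_mem_blockClass hq0 h
  simp only [blockClass, Set.mem_ofPred_eq] at h ⊢
  set d := Nat.findGreatest (fun i => InBlock q pos t i x) N
  set e := Nat.findGreatest (fun i => InBlock q pos t i y) N
  have hde : d ≤ e := Nat.le_findGreatest (Nat.findGreatest_le _) fun z hz => by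
    rw [hxd z (hz.trans h), hblock]
  have hxy : q e y = q e x := nested_of_le hq hde h
  have hed : e ≤ d := Nat.le_findGreatest (Nat.findGreatest_le _) fun z hz => by
    rw [hyd z (hz.trans hxy.symm), hblock]
  rw [le_antisymm hed hde, h]

/-- The point in the middle of the block of `x` of length `2 ^ (t + 1)`. -/
noncomputable def middle (pos : X → ℕ) (t : ℕ) (x : X) : X :=
  @Function.invFun _ _ ⟨x⟩ pos ((2 * (pos x / 2 ^ (t + 1)) + 1) * 2 ^ t)

/-- `x` enters `middle` otherwise only as a proof of nonemptiness. So the middle is constant on each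
set `blockClass q pos N (t + 1) x`, even when no point has the middle position. -/
theorem middle_eq_of_div_eq {t : ℕ} {x y : X} (h : pos y / 2 ^ (t + 1) = pos x / 2 ^ (t + 1)) :
    middle pos t y = middle pos t x := by
  rw [middle, middle, h]

end Blocks

/-! ### The three kinds of coordinates -/

section Coordinates

variable {X : Type u} [MetricSpace X] (q : ℕ → X → X) (pos : X → ℕ) (N : ℕ) (T lam : ℝ)

/-- The distance to the boundary of the class of `x` in a block, with a sign that depends on the
parity of the block. -/
noncomputable def signedCoord (t : ℕ) (x : X) : ℝ :=
  (if Even (pos x / 2 ^ t) then 1 else -1) * distCompl T (blockClass q pos N t x) x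

open Classical in
/-- The distance to the boundary of the class of `x` in a block if the class contains the middle of
the block. -/
noncomputable def straddleCoord (t : ℕ) (x : X) : ℝ :=
  if middle pos t x ∈ blockClass q pos N (t + 1) x then
    distCompl T (blockClass q pos N (t + 1) x) x else 0

open Classical in
/-- The scaled distance to the middle of the block of `x`, capped by the distance to the boundary
of the class of `x` in the block, if the class contains the middle of the block. -/
noncomputable def radialCoord (t : ℕ) (x : X) : ℝ :=
  if middle pos t x ∈ blockClass q pos N (t + 1) x then
    min (distCompl T (blockClass q pos N (t + 1) x) x) (dist x (middle pos t x) / lam) else 0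

variable {q pos N T lam}

/-- If the class of `x` at index `i` contains the middle of a block that contains this class and
`y`, then `x` and `y` are separated. -/
theorem separated_of_straddle (hq : ∀ i x y, q i x = q i y → q (i + 1) x = q (i + 1) y)
    (hq0 : Function.Injective (q 0)) (hlam : 0 < lam) {i t : ℕ} (hi : i ≤ N)
    {x y : X} {τ D : ℝ} (hτ : 0 < τ) (hτT : τ ≤ T) (hD : lam * τ = 4 * D)
    (hpad : ∀ z, dist x z < τ → q i z = q i x) (hdiam : ∀ z, q i z = q i x → dist z x ≤ D)
    (hxy : 4 * D ≤ dist x y) (hblock : InBlock q pos (t + 1) i x)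
    (hyx : pos y / 2 ^ (t + 1) = pos x / 2 ^ (t + 1))
    (hmid : q i (middle pos t x) = q i x) :
    τ / 4 ≤ |straddleCoord q pos N T t x - straddleCoord q pos N T t y| ∨
      τ / 4 ≤ |radialCoord q pos N T lam t x - radialCoord q pos N T lam t y| := by
  have hsub : ∀ z, q i z = q i x → z ∈ blockClass q pos N (t + 1) x := fun z =>
    class_subset_blockClass hq hi hblock
  have hg : τ ≤ distCompl T (blockClass q pos N (t + 1) x) x :=
    le_distCompl hτT fun z hz => hsub z (hpad z hz)
  have hsx : straddleCoord q pos N T t x = distCompl T (blockClass q pos N (t + 1) x) x :=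
    if_pos (hsub _ hmid)
  by_cases hy : y ∈ blockClass q pos N (t + 1) x
  · have hsy : straddleCoord q pos N T t y = distCompl T (blockClass q pos N (t + 1) x) y := by
      rw [straddleCoord, middle_eq_of_div_eq hyx, blockClass_eq_of_mem hq hq0 hy, if_pos (hsub _ hmid)]
    have hry : radialCoord q pos N T lam t y = min (distCompl T (blockClass q pos N (t + 1) x) y)
        (dist y (middle pos t x) / lam) := by
      rw [radialCoord, middle_eq_of_div_eq hyx, blockClass_eq_of_mem hq hq0 hy, if_pos (hsub _ hmid)]
    have hrx : radialCoord q pos N T lam t x ≤ τ / 4 := by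
      rw [radialCoord, if_pos (hsub _ hmid)]
      refine (min_le_right _ _).trans ((div_le_iff₀ hlam).2 ?_)
      have := hdiam _ hmid
      rw [dist_comm] at this
      linarith
    have hfar : 3 * τ / 4 ≤ dist y (middle pos t x) / lam := by
      rw [le_div_iff₀ hlam]
      have h1 := hdiam _ hmid
      have h2 := dist_triangle_right x y (middle pos t x)
      rw [dist_comm] at h1
      linarith
    -- If `y` is deep in the class, its radial coordinate is at least `3 * τ / 4` while that of `x`
    -- is at most `τ / 4`; if not, the boundary distances differ by at least `τ / 4`.
    by_cases hgy : 3 * τ / 4 ≤ distCompl T (blockClass q pos N (t + 1) x) y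
    · right
      rw [hry, abs_sub_comm]
      have := le_min hgy hfar
      exact le_trans (by linarith) (le_abs_self _)
    · left
      rw [hsx, hsy]
      exact le_trans (by linarith) (le_abs_self _)
  · left
    have hsy : straddleCoord q pos N T t y = 0 := by
      refine if_neg fun h => hy ?_
      rw [middle_eq_of_div_eq hyx] at h
      have h1 := blockClass_eq_of_mem hq hq0 h
      rw [blockClass_eq_of_mem hq hq0 (hsub _ hmid)] at h1
      rw [h1]
      exact mem_blockClass_self _ _
    rw [hsx, hsy, sub_zero]
    exact le_trans (by linarith) (le_abs_self _)

/-- If the class of `x` at index `i` and `y` lie in dyadic blocks of the same length and different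
parity, then `x` and `y` are separated. -/
theorem separated_of_parity (hq : ∀ i x y, q i x = q i y → q (i + 1) x = q (i + 1) y)
    (hT : 0 ≤ T) {i t : ℕ} (hi : i ≤ N)
    {x y : X} {τ : ℝ} (hτT : τ ≤ T) (hpad : ∀ z, dist x z < τ → q i z = q i x)
    (hblock : InBlock q pos t i x) (hpar : Even (pos x / 2 ^ t) ↔ ¬ Even (pos y / 2 ^ t)) :
    τ ≤ |signedCoord q pos N T t x - signedCoord q pos N T t y| := by
  have hg : τ ≤ distCompl T (blockClass q pos N t x) x :=
    le_distCompl hτT fun z hz => class_subset_blockClass hq hi hblock (hpad z hz)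
  have hy : 0 ≤ distCompl T (blockClass q pos N t y) y := distCompl_nonneg hT
  by_cases hx : Even (pos x / 2 ^ t)
  · rw [signedCoord, signedCoord, if_pos hx, if_neg (hpar.1 hx)]
    exact le_trans (by linarith) (le_abs_self _)
  · rw [signedCoord, signedCoord, if_neg hx, if_pos (not_not.1 (mt hpar.2 hx)), abs_sub_comm]
    exact le_trans (by linarith) (le_abs_self _)

variable [Finite X]

theorem abs_signedCoord_sub_le (hq : ∀ i x y, q i x = q i y → q (i + 1) x = q (i + 1) y)
    (hq0 : Function.Injective (q 0)) (hT : 0 ≤ T) (t : ℕ) (x y : X) :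
    |signedCoord q pos N T t x - signedCoord q pos N T t y| ≤ 2 * dist x y := by
  have habs : ∀ n : ℕ, |if Even n then (1 : ℝ) else -1| = 1 := fun n => by split_ifs <;> simp
  refine abs_sub_le_of_partition (mem_blockClass_self (q := q) (pos := pos) (N := N) t)
    (fun x y => blockClass_eq_of_mem hq hq0) (T := T) (fun x => ?_) (fun x y h => ?_) x y
  · rw [signedCoord, abs_mul, habs, one_mul, abs_of_nonneg (distCompl_nonneg hT)]
  · rw [signedCoord, signedCoord, div_eq_of_mem_blockClass hq0 h, blockClass_eq_of_mem hq hq0 h,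
      ← mul_sub, abs_mul, habs, one_mul]
    exact abs_distCompl_sub_le

theorem abs_straddleCoord_sub_le (hq : ∀ i x y, q i x = q i y → q (i + 1) x = q (i + 1) y)
    (hq0 : Function.Injective (q 0)) (hT : 0 ≤ T) (t : ℕ) (x y : X) :
    |straddleCoord q pos N T t x - straddleCoord q pos N T t y| ≤ 2 * dist x y := by
  refine abs_sub_le_of_partition (mem_blockClass_self (q := q) (pos := pos) (N := N) (t + 1))
    (fun x y => blockClass_eq_of_mem hq hq0) (T := T) (fun x => ?_) (fun x y h => ?_) x y
  · rw [straddleCoord]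
    split_ifs
    · rw [abs_of_nonneg (distCompl_nonneg hT)]
    · rw [abs_zero]
      exact distCompl_nonneg hT
  · rw [straddleCoord, straddleCoord, middle_eq_of_div_eq (div_eq_of_mem_blockClass hq0 h),
      blockClass_eq_of_mem hq hq0 h]
    split_ifs
    · exact abs_distCompl_sub_le
    · simp

theorem abs_radialCoord_sub_le (hq : ∀ i x y, q i x = q i y → q (i + 1) x = q (i + 1) y)
    (hq0 : Function.Injective (q 0)) (hT : 0 ≤ T) (hlam : 1 ≤ lam) (t : ℕ) (x y : X) :
    |radialCoord q pos N T lam t x - radialCoord q pos N T lam t y| ≤ 2 * dist x y := by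
  have hlam0 : 0 < lam := by linarith
  refine abs_sub_le_of_partition (mem_blockClass_self (q := q) (pos := pos) (N := N) (t + 1))
    (fun x y => blockClass_eq_of_mem hq hq0) (T := T) (fun x => ?_) (fun x y h => ?_) x y
  · rw [radialCoord]
    split_ifs
    · rw [abs_of_nonneg (le_min (distCompl_nonneg hT) (by positivity))]
      exact min_le_left _ _
    · rw [abs_zero]
      exact distCompl_nonneg hT
  · rw [radialCoord, radialCoord, middle_eq_of_div_eq (div_eq_of_mem_blockClass hq0 h),
      blockClass_eq_of_mem hq hq0 h]
    split_ifs
    · refine (abs_min_sub_min_le_max _ _ _ _).trans (max_le abs_distCompl_sub_le ?_)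
      rw [← sub_div, abs_div, abs_of_pos hlam0, div_le_iff₀ hlam0]
      refine (abs_dist_sub_le x y _).trans ?_
      exact le_mul_of_one_le_right dist_nonneg hlam
    · simp

end Coordinates

/-- Finitely many nested partitions of an `n`-point metric space have `O(log n)` Lipschitz functions
that separate every pair of points `x`, `y` one of whose classes contains a ball around `x` and is
small compared with the distance of `x` and `y`. -/
theorem exists_separating_functions {X : Type u} [MetricSpace X] [Fintype X] (N : ℕ)
    (q : ℕ → X → X) (hq : ∀ i x y, q i x = q i y → q (i + 1) x = q (i + 1) y)
    (hq0 : Function.Injective (q 0)) {T lam : ℝ} (hT : 0 ≤ T) (hlam : 1 ≤ lam) {L : ℕ}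
    (hL : Fintype.card X ≤ 2 ^ L) :
    ∃ F : Fin 3 × Fin L → X → ℝ, (∀ c x y, |F c x - F c y| ≤ 2 * dist x y) ∧
      ∀ i ≤ N, ∀ x y τ D, 0 < τ → τ ≤ T → lam * τ = 4 * D →
        (∀ z, dist x z < τ → q i z = q i x) → (∀ z, q i z = q i x → dist z x ≤ D) →
        4 * D ≤ dist x y → ∃ c, τ / 4 ≤ |F c x - F c y| := by
  obtain ⟨e, hconv⟩ := exists_convex_order N q hq hq0
  set pos : X → ℕ := fun x => e x with hpos
  have hinj : Function.Injective pos := fun x y h => e.injective (Fin.ext h)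
  have hconv' : ∀ i ≤ N, ∀ x y z, pos x ≤ pos y → pos y ≤ pos z → q i x = q i z → q i y = q i x :=
    hconv
  refine ⟨fun c x => ![signedCoord q pos N T c.2 x, straddleCoord q pos N T c.2 x,
    radialCoord q pos N T lam c.2 x] c.1, ?_, ?_⟩
  · rintro ⟨c, t⟩ x y
    fin_cases c
    · exact abs_signedCoord_sub_le hq hq0 hT t x y
    · exact abs_straddleCoord_sub_le hq hq0 hT t x y
    · exact abs_radialCoord_sub_le hq hq0 hT hlam t x y
  intro i hi x y τ D hτ hτT hD hpad hdiam hxy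
  have hDpos : 0 < D := by nlinarith
  have hyC : q i y ≠ q i x := fun h => by
    have := hdiam y h
    rw [dist_comm] at this
    linarith
  -- an extremal point `g` of the class such that the class lies between `g` and `y`
  obtain ⟨g, hg, hbetween⟩ : ∃ g, q i g = q i x ∧ ∀ z, q i z = q i x →
      min (pos y) (pos g) ≤ pos z ∧ pos z ≤ max (pos y) (pos g) := by
    by_cases hlt : ∀ z, q i z = q i x → pos z < pos y
    · obtain ⟨g, hg, hmin⟩ := Set.exists_min_image {z | q i z = q i x} pos (Set.toFinite _) ⟨x, rfl⟩
      exact ⟨g, hg, fun z hz => ⟨(min_le_right _ _).trans (hmin z hz),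
        (hlt z hz).le.trans (le_max_left _ _)⟩⟩
    · push Not at hlt
      obtain ⟨w, hw, hyw⟩ := hlt
      have hgt : ∀ z, q i z = q i x → pos y ≤ pos z := by
        intro z hz
        by_contra! hzy
        exact hyC ((hconv' i hi z y w hzy.le hyw (hz.trans hw.symm)).trans hz)
      obtain ⟨g, hg, hmax⟩ := Set.exists_max_image {z | q i z = q i x} pos (Set.toFinite _) ⟨x, rfl⟩
      exact ⟨g, hg, fun z hz => ⟨(min_le_left _ _).trans (hgt z hz),
        (hmax z hz).trans (le_max_right _ _)⟩⟩
  have hyg : pos y ≠ pos g := fun h => hyC (hinj h ▸ hg)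
  obtain ⟨t, h1, h2, h3⟩ := exists_dyadic_separation (min_lt_max.2 hyg)
  set b := max (pos y) (pos g) / 2 ^ (t + 1) with hb
  have hsame : ∀ n, min (pos y) (pos g) ≤ n → n ≤ max (pos y) (pos g) → n / 2 ^ (t + 1) = b :=
    fun n hn hn' => le_antisymm (Nat.div_le_div_right hn') (h1 ▸ Nat.div_le_div_right hn)
  have hclass : ∀ z, q i z = q i x → pos z / 2 ^ (t + 1) = b := fun z hz =>
    hsame _ (hbetween z hz).1 (hbetween z hz).2
  have hyb : pos y / 2 ^ (t + 1) = b := hsame _ (min_le_left _ _) (le_max_left _ _)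
  have hhalf : ∀ n, n / 2 ^ (t + 1) = b → n / 2 ^ t = 2 * b ∨ n / 2 ^ t = 2 * b + 1 := by
    intro n hn
    rw [pow_succ, ← Nat.div_div_eq_div_mul] at hn
    omega
  have hyg' : pos y / 2 ^ t = 2 * b ∧ pos g / 2 ^ t = 2 * b + 1 ∨
      pos g / 2 ^ t = 2 * b ∧ pos y / 2 ^ t = 2 * b + 1 := by
    rcases le_total (pos y) (pos g) with h | h
    · rw [min_eq_left h] at h2
      rw [max_eq_right h] at h3
      exact .inl ⟨h2, h3⟩
    · rw [min_eq_right h] at h2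
      rw [max_eq_left h] at h3
      exact .inr ⟨h2, h3⟩
  -- All positions are below `2 ^ L`, so blocks of length `2 ^ L` or more cannot distinguish `y`
  -- from `g`.
  have htL : t < L := by
    by_contra! hLt
    have hlt : ∀ z, pos z / 2 ^ t = 0 := fun z => Nat.div_eq_of_lt
      (((e z).2.trans_le hL).trans_le (Nat.pow_le_pow_right two_pos hLt))
    rw [hlt, hlt] at hyg'
    omega
  by_cases hone : ∀ z, q i z = q i x → pos z / 2 ^ t = pos g / 2 ^ t
  · refine ⟨(0, ⟨t, htL⟩), le_trans (by linarith) (separated_of_parity hq hT hi hτT hpad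
      (fun z hz => by rw [hone z hz, hone x rfl]) ?_)⟩
    rw [hone x rfl]
    rcases hyg' with ⟨h, h'⟩ | ⟨h, h'⟩ <;> rw [h, h'] <;> simp [parity_simps]
  · push Not at hone
    obtain ⟨w, hw, hwg⟩ := hone
    obtain ⟨u, v, hu, hv, hub, hvb⟩ : ∃ u v, q i u = q i x ∧ q i v = q i x ∧
        pos u / 2 ^ t = 2 * b ∧ pos v / 2 ^ t = 2 * b + 1 := by
      rcases hhalf _ (hclass w hw) with h | h <;> rcases hhalf _ (hclass g hg) with h' | h'
      · exact absurd (h.trans h'.symm) hwg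
      · exact ⟨w, g, hw, hg, h, h'⟩
      · exact ⟨g, w, hg, hw, h', h⟩
      · exact absurd (h.trans h'.symm) hwg
    have hMv : (2 * b + 1) * 2 ^ t ≤ pos v := by
      rw [← hvb]
      exact Nat.div_mul_le_self _ _
    have huM : pos u ≤ (2 * b + 1) * 2 ^ t := by
      have := Nat.lt_div_mul_add (a := pos u) (b := 2 ^ t) (by positivity)
      rw [hub] at this
      linarith
    have hmid : pos (middle pos t x) = (2 * b + 1) * 2 ^ t := by
      rw [middle, hclass x rfl]
      refine @Function.invFun_eq _ _ ⟨x⟩ _ _ ⟨e.symm ⟨(2 * b + 1) * 2 ^ t, hMv.trans_lt (e v).2⟩, ?_⟩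
      simp [hpos]
    -- The class has points in both halves of the block; being an interval, it contains the middle.
    have hmid' : q i (middle pos t x) = q i x :=
      (hconv' i hi u _ v (hmid ▸ huM) (hmid ▸ hMv) (hu.trans hv.symm)).trans hu
    rcases separated_of_straddle hq hq0 (by linarith) hi hτ hτT hD hpad hdiam hxy
      (fun z hz => by rw [hclass z hz, hclass x rfl]) (hyb.trans (hclass x rfl).symm) hmid' with h | h
    · exact ⟨(1, ⟨t, htL⟩), h⟩
    · exact ⟨(2, ⟨t, htL⟩), h⟩

/-! ### Assembling all scales -/

/-- Padded partitions at all scales yield an embedding into `ℓ_∞`. -/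
theorem exists_lipschitz_family_of_padded_partitions {X : Type u} [MetricSpace X] [Fintype X]
    [Nontrivial X] {I : Type w} {K : ℝ} (hK : 1 ≤ K)
    (hpart : ∀ ρ : ℝ, 0 < ρ → ∃ E : I → Setoid X, (∀ l x y, E l x y → dist x y ≤ K * ρ) ∧
      ∀ x, ∃ l, ∀ y, dist x y < ρ → E l x y)
    {A L : ℕ} (hA : 4 * K ≤ 2 ^ A) (hL : Fintype.card X ≤ 2 ^ L) :
    ∃ F : (I × Fin A) × (Fin 3 × Fin L) → X → ℝ, (∀ c x y, |F c x - F c y| ≤ 2 * dist x y) ∧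
      ∀ x y, ∃ c, dist x y / (256 * K) ≤ |F c x - F c y| := by
  have hA0 : A ≠ 0 := by
    rintro rfl
    linarith
  obtain ⟨⟨x₀, y₀⟩, hxy₀, hmin⟩ := Set.exists_min_image {p : X × X | p.1 ≠ p.2}
    (fun p => dist p.1 p.2) (Set.toFinite _)
    (by obtain ⟨x, y, h⟩ := exists_pair_ne X; exact ⟨(x, y), h⟩)
  have hd₀ : 0 < dist x₀ y₀ := dist_pos.2 hxy₀
  -- So small that every pair has a scale index `n ≥ A`: index 0 of a hierarchy is the identity, so
  -- a usable scale has the form `a + A * (i + 1)`.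
  set ρ₀ : ℝ := dist x₀ y₀ / (16 * K * 2 ^ A) with hρ₀
  have hρ₀pos : 0 < ρ₀ := by positivity
  have hsmall : ∀ x y : X, x ≠ y → 16 * K * ρ₀ * 2 ^ A ≤ dist x y := by
    intro x y h
    have h1 := hmin (x, y) h
    have h2 : 16 * K * ρ₀ * 2 ^ A = dist x₀ y₀ := by
      rw [hρ₀]
      field_simp
    rw [h2]
    exact h1
  obtain ⟨M, hM⟩ := (Set.finite_range fun p : X × X => dist p.1 p.2).bddAbove
  obtain ⟨N, hN⟩ := pow_unbounded_of_one_lt (M / (16 * K * ρ₀)) one_lt_two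
  have hlarge : ∀ x y : X, dist x y < 16 * K * ρ₀ * 2 ^ N := by
    intro x y
    rw [div_lt_iff₀ (by positivity)] at hN
    have := hM ⟨(x, y), rfl⟩
    dsimp only at this
    linarith
  have hscale : ∀ n : ℕ, 0 < ρ₀ * 2 ^ n := fun n => by positivity
  choose E hE hEpad using fun n : ℕ => hpart (ρ₀ * 2 ^ n) (hscale n)
  have hgrow : ∀ a i : ℕ, 4 * K * (ρ₀ * 2 ^ (a + A * i)) ≤ ρ₀ * 2 ^ (a + A * (i + 1)) := by
    intro a i
    have h1 : (2 : ℝ) ^ (a + A * (i + 1)) = 2 ^ A * 2 ^ (a + A * i) := by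
      rw [← pow_add]
      ring_nf
    rw [h1]
    have := mul_le_mul_of_nonneg_right hA (hscale (a + A * i)).le
    linarith
  -- One hierarchy per shift choice `l` and residue `a`, with the same `l` at all its scales: a pair
  -- needs padding only at its own scale.
  have hF := fun la : I × Fin A => exists_separating_functions (L := L) N
    (representative fun i => E (la.2 + A * i) la.1) (fun _ _ _ => representative_nested)
    (fun _ _ h => h) (T := ρ₀ * 2 ^ N) (hscale N).le (lam := 32 * K) (by linarith) hL
  choose F hFlip hFsep using hF
  refine ⟨fun c => F c.1 c.2, fun c => hFlip c.1 c.2, fun x y => ?_⟩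
  by_cases hxy : x = y
  · subst hxy
    have hcard : 1 < Fintype.card X := Fintype.one_lt_card
    have hL0 : L ≠ 0 := by
      rintro rfl
      omega
    obtain ⟨l, -⟩ := hEpad 0 x
    exact ⟨((l, ⟨0, by omega⟩), (0, ⟨0, by omega⟩)), by simp⟩
  have hd := hsmall x y hxy
  have hbase : 0 < 16 * K * ρ₀ := by positivity
  obtain ⟨n, hn, hn'⟩ := exists_nat_pow_near (x := dist x y / (16 * K * ρ₀)) (y := 2) (by
    rw [le_div_iff₀ hbase, one_mul]
    exact (le_mul_of_one_le_right hbase.le (one_le_pow₀ one_le_two)).trans hd) one_lt_two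
  rw [le_div_iff₀ hbase] at hn
  rw [div_lt_iff₀ hbase] at hn'
  have hAn : A ≤ n := by
    have h1 : (2 : ℝ) ^ A < 2 ^ (n + 1) := lt_of_mul_lt_mul_right (a := 16 * K * ρ₀)
      (by linarith) hbase.le
    have := (pow_lt_pow_iff_right₀ (one_lt_two (α := ℝ))).1 h1
    omega
  have hnN : n < N := by
    have h1 : (2 : ℝ) ^ n < 2 ^ N := lt_of_mul_lt_mul_right (a := 16 * K * ρ₀)
      (by linarith [hlarge x y]) hbase.le
    exact (pow_lt_pow_iff_right₀ (one_lt_two (α := ℝ))).1 h1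
  obtain ⟨i, hi⟩ : ∃ i, n / A = i + 1 :=
    Nat.exists_eq_succ_of_ne_zero (Nat.div_pos hAn (Nat.pos_of_ne_zero hA0)).ne'
  set a : Fin A := ⟨n % A, Nat.mod_lt _ (Nat.pos_of_ne_zero hA0)⟩ with ha
  have hna : (a : ℕ) + A * (i + 1) = n := by
    rw [← hi]
    exact Nat.mod_add_div n A
  obtain ⟨l, hl⟩ := hEpad n x
  have hiN : i + 1 ≤ N := by
    rw [← hi]
    exact (Nat.div_le_self n A).trans hnN.le
  have hρ := fun j : ℕ => hscale (a + A * j)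
  have hEdiam : ∀ j x y, E (a + A * j) l x y → dist x y ≤ K * (ρ₀ * 2 ^ (a + A * j)) :=
    fun j => hE (a + A * j) l
  have hpow : (2 : ℝ) ^ n ≤ 2 ^ N := pow_le_pow_right₀ one_le_two hnN.le
  -- Nesting halves the padding and makes the diameter `4 * K` times the scale, which fixes `lam =
  -- 32 * K`. Then `τ / 4` is an eighth of the scale, while `dist x y` is below `32 * K` times it.
  obtain ⟨c, hc⟩ := hFsep (l, a) (i + 1) hiN x y (ρ₀ * 2 ^ n / 2) (4 * K * (ρ₀ * 2 ^ n))
    (by linarith [hscale n])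
    (by linarith [mul_le_mul_of_nonneg_left hpow hρ₀pos.le, hscale n]) (by ring)
    (fun z hz => representative_eq_of_padded (E := fun j => E (a + A * j) l) hK hρ (hgrow a) hEdiam
      (by rw [hna]; exact hl) (by rw [hna]; exact hz))
    (fun z hz => by
      have := dist_le_of_representative_eq (E := fun j => E (a + A * j) l) hK hρ (hgrow a) hEdiam hz
      rwa [hna] at this)
    (by linarith)
  refine ⟨((l, a), c), le_trans ?_ hc⟩
  rw [div_le_iff₀ (by positivity)]
  rw [pow_succ] at hn'
  linarith

theorem clog_two_le {m : ℕ} (hm : 2 ≤ m) : (Nat.clog 2 m : ℝ) ≤ 2 * Real.log m + 1 := by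
  have h1 : 2 ^ (Nat.clog 2 m).pred < m := Nat.pow_pred_clog_lt_self one_lt_two hm
  have h2 : Nat.clog 2 m = (Nat.clog 2 m).pred + 1 :=
    (Nat.succ_pred (Nat.clog_pos one_lt_two hm).ne').symm
  have h3 : ((2 : ℝ) ^ (Nat.clog 2 m).pred) ≤ m := by exact_mod_cast h1.le
  have h4 := Real.log_le_log (by positivity) h3
  rw [Real.log_pow] at h4
  rw [h2, Nat.cast_succ]
  have h5 := Real.log_two_gt_d9
  have h6 : (0 : ℝ) ≤ (Nat.clog 2 m).pred := Nat.cast_nonneg _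
  nlinarith

theorem distortionAtMost_of_subsingleton {X : Type u} [MetricSpace X] [Subsingleton X]
    {Y : Type v} [MetricSpace Y] (f : X → Y) (K : ℝ) : DistortionAtMost f K :=
  ⟨1, one_pos, fun x y => by rw [Subsingleton.elim x y]; simp⟩

end MinorFreeMetric

/-! ### The theorem, with explicit constants -/

theorem theorem4 :
    ∃ C₁ C₂ : ℝ, 0 < C₁ ∧ 0 < C₂ ∧
      ∀ (s : ℕ) (X : Type u) [MetricSpace X] [Fintype X],
        MinorFreeMetric.ExcludesBicliqueMinor.{u, v} X s →
        ∃ (k : ℕ) (f : X → (Fin k → ℝ)), -- the metric on `Fin k → ℝ` is that of the sup norm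
          (k : ℝ) ≤ C₁ * ((3 : ℝ) ^ s * Real.log (s : ℝ) * Real.log (Fintype.card X : ℝ)) ∧
          MinorFreeMetric.DistortionAtMost f (C₂ * (s : ℝ) ^ 2) := by
  refine ⟨300, 512 * 88, by norm_num, by norm_num, fun s X _ _ hX => ?_⟩
  have hlog_nonneg : ∀ n : ℕ, 0 ≤ Real.log n := fun n => Real.log_natCast_nonneg n
  rcases subsingleton_or_nontrivial X with hsub | hnon
  · refine ⟨0, fun _ => 0, ?_, MinorFreeMetric.distortionAtMost_of_subsingleton _ _⟩
    have := mul_nonneg (mul_nonneg (pow_nonneg (zero_le_three (α := ℝ)) s) (hlog_nonneg s))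
      (hlog_nonneg (Fintype.card X))
    rw [Nat.cast_zero]
    linarith
  -- For `s = 1` the bound on `k` is zero because `log 1 = 0`, but then the space has at most one
  -- point.
  have hs : 2 ≤ s := by
    have h0 := hX.ne_zero
    have h1 : s ≠ 1 := by
      rintro rfl
      exact not_subsingleton X hX.subsingleton
    omega
  have hs' : (2 : ℝ) ≤ s := by exact_mod_cast hs
  have hcard : 2 ≤ Fintype.card X := Fintype.one_lt_card
  have hK : (1 : ℝ) ≤ 88 * s ^ 2 := by nlinarith
  have hA : 4 * (88 * (s : ℝ) ^ 2) ≤ 2 ^ Nat.clog 2 (352 * s ^ 2) := by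
    have h : ((352 * s ^ 2 : ℕ) : ℝ) ≤ ((2 ^ Nat.clog 2 (352 * s ^ 2) : ℕ) : ℝ) :=
      Nat.cast_le.2 (Nat.le_pow_clog one_lt_two _)
    push_cast at h
    linarith
  set A := Nat.clog 2 (352 * s ^ 2) with hAdef
  set L := Nat.clog 2 (Fintype.card X) with hLdef
  obtain ⟨F, hlip, hsep⟩ := MinorFreeMetric.exists_lipschitz_family_of_padded_partitions hK
    (fun ρ hρ => hX.exists_padded_partitions (by omega) hρ) hA
    (Nat.le_pow_clog one_lt_two (Fintype.card X))
  let e := Fintype.equivFin ((List.Vector Bool s × Fin A) × (Fin 3 × Fin L))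
  refine ⟨_, fun x j => F (e.symm j) x, ?_, 2, two_pos, fun x y => ⟨?_, ?_⟩⟩
  · have hlog2 : (0.69 : ℝ) < Real.log 2 := by linarith [Real.log_two_gt_d9]
    have hlogs : Real.log 2 ≤ Real.log s := Real.log_le_log two_pos hs'
    have hlogn : Real.log 2 ≤ Real.log (Fintype.card X) :=
      Real.log_le_log two_pos (by exact_mod_cast hcard)
    have hLle : (L : ℝ) ≤ 4 * Real.log (Fintype.card X) := by
      linarith [MinorFreeMetric.clog_two_le hcard]
    have hAle : (A : ℝ) ≤ 25 * Real.log s := by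
      have h1 := MinorFreeMetric.clog_two_le (m := 352 * s ^ 2) (by nlinarith)
      have h2 : Real.log ((352 * s ^ 2 : ℕ) : ℝ) ≤ 11 * Real.log s := by
        have h3 : ((352 * s ^ 2 : ℕ) : ℝ) ≤ (s : ℝ) ^ 11 := by
          push_cast
          have h4 : (2 : ℝ) ^ 9 ≤ (s : ℝ) ^ 9 := pow_le_pow_left₀ zero_le_two hs' 9
          have h5 : (352 : ℝ) ≤ (s : ℝ) ^ 9 := le_trans (by norm_num) h4
          calc (352 : ℝ) * (s : ℝ) ^ 2 ≤ (s : ℝ) ^ 9 * (s : ℝ) ^ 2 := by gcongr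
            _ = (s : ℝ) ^ 11 := by ring
        have h6 := Real.log_le_log (by positivity) h3
        rw [Real.log_pow] at h6
        exact_mod_cast h6
      linarith
    -- The construction uses only `2 ^ s` partitions per scale, which is within the permitted `3 ^
    -- s`.
    have hpow : (2 : ℝ) ^ s ≤ 3 ^ s := pow_le_pow_left₀ zero_le_two (by norm_num) s
    simp only [Fintype.card_prod, Fintype.card_fin, card_vector, Fintype.card_bool]
    push_cast
    calc (2 : ℝ) ^ s * A * (3 * L)
        ≤ 3 ^ s * (25 * Real.log s) * (3 * (4 * Real.log (Fintype.card X))) := by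
          gcongr
      _ = 300 * (3 ^ s * Real.log s * Real.log (Fintype.card X)) := by ring
  · obtain ⟨c, hc⟩ := hsep x y
    have h1 := dist_le_pi_dist (fun j => F (e.symm j) x) (fun j => F (e.symm j) y) (e c)
    simp only [Equiv.symm_apply_apply] at h1
    rw [Real.dist_eq] at h1
    refine le_trans (le_of_eq ?_) (hc.trans h1)
    field_simp
    ring
  · refine (dist_pi_le_iff (by positivity)).2 fun j => ?_
    rw [Real.dist_eq]
    exact hlip _ x y
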